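/- Let $r\ge 0$ be a fixed integer. For each $N$ let $\{B_N^{s,t}:1\le s,t\le r\}$ be a family of real random $N\times N$ matrices with $(B_N^{s,t})^{T}=B_N^{t,s}$, and let $y_N^{(s)}=(y_{Nj}^{(s)})_{1\le j\le N}$, $1\le s\le r$, be real random $N$-vectors, defined on the same probability space (which may depend on $N$), such that the family $\{B_N^{s,t}\}_{s,t}$ is independent of the family $\{y_N^{(s)}\}_s$ and all the entries $y_{Nj}^{(s)}$, $1\le s\le r$, $1\le j\le N$, are jointly independent with $\mathbb E\,y_{Nj}^{(s)}=0$, $\mathbb E\,|y_{Nj}^{(s)}|^2=1$ and $\sup_{N,j,s}\mathbb E|y_{Nj}^{(s)}|^4=m_4<\infty$. Put $\kappa_4(y_{Ni}^{(s)})=\mathbb E|y_{Ni}^{(s)}|^4-3$, and assume that, as $N\to\infty$: (i) for every $\epsilon>0$ and every $1\le s\le r$, $\displaystyle \frac1N\sum_{j=1}^N\mathbb E\Big[\big||y_{Nj}^{(s)}|^2-1\big|^2\,\mathbf 1_{\{||y_{Nj}^{(s)}|^2-1|>\epsilon\sqrt N\}}\Big]\to 0$; (ii) there is a constant $a>0$,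 not depending on $N$, such that almost surely $\max_{1\le s,t\le r}\|B_N^{s,t}\|\le a$ (operator norm); (iii) for all $1\le s,t\le r$, $\frac1N\operatorname{Tr}\big((B_N^{s,t})^{T}B_N^{s,t}\big)$ converges in probability to a number $a_2(s,t)$; (iv) for all $1\le s\le r$, $\frac1N\sum_{i=1}^N (B_N^{s,s})_{ii}^2\,\kappa_4(y_{Ni}^{(s)})$ converges in probability to a number $a_1(s)$. Then $a_2(s,t)\ge 0$ for $s\ne t$, $a_1(s)+2a_2(s,s)\ge 0$ for all $s$, and the random $r\times r$ matrix $$G_N=\frac1{\sqrt N}\Big((y_N^{(s)})^{T}B_N^{s,t}y_N^{(t)}-\delta_{s,t}\operatorname{Tr}B_N^{s,t}\Big)_{1\le s,t\le r}$$ converges in distribution, as $N\to\infty$, to a random real symmetric $r\times r$ matrix $G$ whose entries $G_{s,t}$, $1\le s\le t\le r$, are independent, with $G_{s,t}\sim\mathcal N(0,a_2(s,t))$ for $s\ne t$ and $G_{s,s}\sim\mathcal N(0,a_1(s)+2a_2(s,s))$ (where $\mathcal N(0,0)$ is the point mass at $0$). -/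

import Mathlib

open MeasureTheory ProbabilityTheory Filter Topology

noncomputable section

/-- Convergence in probability to a real constant `c` of random variables `X N`, where `X N` lives
on its own probability space `(Ω N, P N)`. -/
def TendstoInProbConst {Ω : ℕ → Type*} [∀ N, MeasurableSpace (Ω N)] (P : ∀ N, Measure (Ω N))
    (X : ∀ N, Ω N → ℝ) (c : ℝ) : Prop :=
  ∀ ε : ℝ, 0 < ε → Tendsto (fun N => P N {ω | ε ≤ |X N ω - c|}) atTop (𝓝 0)

/-- The fourth cumulant `E|X|^4 - 3` of a real standardized random variable. -/
def kappa4 {Ω : Type*} [MeasurableSpace Ω] (P : Measure Ω) (X : Ω → ℝ) : ℝ :=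
  (∫ ω, |X ω| ^ 4 ∂P) - 3

/-- The Lindeberg quantity
`(1/N) ∑ⱼ E[ ||y_j|² - 1|² ; ||y_j|² - 1| > ε √N ]` of a random `N`-vector `y`. -/
def lindebergSum {Ω : Type*} [MeasurableSpace Ω] (P : Measure Ω) {N : ℕ} (y : Fin N → Ω → ℝ)
    (ε : ℝ) : ℝ :=
  (1 / (N : ℝ)) * ∑ j : Fin N,
    ∫ ω in {ω | ε * √(N : ℝ) < |(|y j ω| ^ 2 - 1)|}, |(|y j ω| ^ 2 - 1)| ^ 2 ∂P

/-- The `r × r` random matrix with `(s, t)` entry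
`N^{-1/2} ((y^{(s)})ᵀ B^{s,t} y^{(t)} - δ_{s,t} Tr B^{s,t})`. -/
def quadFormMatrix {Ω : Type*} {r N : ℕ} (y : Fin r → Fin N → Ω → ℝ)
    (B : Fin r → Fin r → Ω → Matrix (Fin N) (Fin N) ℝ) (ω : Ω) : Fin r → Fin r → ℝ :=
  fun s t => (1 / √(N : ℝ)) *
    ((fun i => y s i ω) ⬝ᵥ (B s t ω).mulVec (fun i => y t i ω)
      - if s = t then (B s t ω).trace else 0)

end

/-!
Consider one centred quadratic form `Q = xᵀ A x - Tr A` with `A` deterministic. Resampling the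
coordinate `x k` with the others held fixed, the summand of `Q` belonging to `k` has mean zero
and its covariance with the increment of `Q` is explicit; the sum over `k` of these covariances
concentrates around `Var Q`, and Lindeberg's condition controls the Taylor remainder of the
exponential. Summing over `k` gives Stein's identity `E[Q e^{iτQ}] ≈ iτ (Var Q) E[e^{iτQ}]`
after normalization, so the characteristic function of `Q` almost solves `φ' = -τ (Var Q) φ` and
Grönwall's argument compares it with the Gaussian one. Conditioning on the matrices makes `A`
random.

By the Cramér–Wold device it suffices to treat the combinations `∑ c s t * G s t`, and each of
them is again a single centred quadratic form: that of the block matrix `(c s t • B s t)` at the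
concatenation of the vectors.
-/

section Exponential

lemma norm_exp_ofReal_mul_I_sub_one_le (x : ℝ) : ‖Complex.exp (x * Complex.I) - 1‖ ≤ |x| := by
  simpa [mul_comm] using Real.norm_exp_I_mul_ofReal_sub_one_le (x := x)

lemma norm_exp_ofReal_mul_I_sub_one_sub_le (x : ℝ) :
    ‖Complex.exp (x * Complex.I) - 1 - x * Complex.I‖ ≤ 2 * |x| :=
  calc _ ≤ ‖Complex.exp (x * Complex.I) - 1‖ + ‖(x : ℂ) * Complex.I‖ := norm_sub_le _ _
    _ ≤ |x| + |x| := add_le_add (norm_exp_ofReal_mul_I_sub_one_le x) (by simp)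
    _ = 2 * |x| := (two_mul _).symm

lemma norm_exp_ofReal_mul_I_sub_one_sub_le_two_mul_sq (x : ℝ) :
    ‖Complex.exp (x * Complex.I) - 1 - x * Complex.I‖ ≤ 2 * x ^ 2 := by
  rcases le_total |x| 1 with h | h
  · have := Complex.norm_exp_sub_one_sub_id_le (x := x * Complex.I) (by simpa using h)
    simp only [norm_mul, Complex.norm_real, Real.norm_eq_abs, Complex.norm_I, mul_one,
      sq_abs] at this
    linarith [sq_nonneg x]
  · refine (norm_exp_ofReal_mul_I_sub_one_sub_le x).trans ?_
    rw [← sq_abs]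
    nlinarith

/-- Expand `e` as `(e - 1 - iτd) + 1 + iτd` against `u` and as `(e - 1) + 1` against `c`. -/
lemma norm_sub_mul_exp_sub_linear_le (u d c τ : ℝ) :
    ‖((u : ℂ) - τ * c * Complex.I) * Complex.exp ((τ * d : ℝ) * Complex.I) -
        ((u : ℂ) + τ * Complex.I * (u * d - c : ℝ))‖ ≤
      |u| * ‖Complex.exp ((τ * d : ℝ) * Complex.I) - 1 - (τ * d : ℝ) * Complex.I‖ +
        τ ^ 2 * |c| * |d| := by
  set e := Complex.exp ((τ * d : ℝ) * Complex.I)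
  have hexpand : ((u : ℂ) - τ * c * Complex.I) * e - ((u : ℂ) + τ * Complex.I * (u * d - c : ℝ)) =
      u * (e - 1 - (τ * d : ℝ) * Complex.I) - τ * c * Complex.I * (e - 1) := by
    push_cast; ring
  have hcross : ‖τ * c * Complex.I * (e - 1)‖ ≤ τ ^ 2 * |c| * |d| := by
    rw [norm_mul, norm_mul, norm_mul, Complex.norm_real, Complex.norm_real, Complex.norm_I]
    calc |τ| * |c| * 1 * ‖e - 1‖ ≤ |τ| * |c| * 1 * |τ * d| := by
          gcongr; exact norm_exp_ofReal_mul_I_sub_one_le _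
      _ = τ ^ 2 * |c| * |d| := by rw [abs_mul, ← sq_abs τ]; ring
  rw [hexpand]
  refine (norm_sub_le _ _).trans (add_le_add ?_ hcross)
  rw [norm_mul, Complex.norm_real, Real.norm_eq_abs]

/-- Lindeberg's truncation: the cubic bound on the remainder is used where `w ≤ L` or where `β`
dominates, the quadratic bound where `w > L`. -/
lemma abs_mul_norm_exp_sub_one_sub_le {α β u d w C L : ℝ} (τ : ℝ) (hu : |u| ≤ |α| + 2 * |β|)
    (hd : |d| ≤ |α| + 2 * |β|) (hα : |α| ≤ C * w) (hw : 0 ≤ w) (hC : 0 ≤ C) (hL : 0 ≤ L) :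
    |u| * ‖Complex.exp ((τ * d : ℝ) * Complex.I) - 1 - (τ * d : ℝ) * Complex.I‖ ≤
      128 * τ ^ 2 * |β| ^ 3 + 8 * C ^ 2 * |τ| *
        (2 * C * L * |τ| * w ^ 2 + {w | L < w}.indicator (fun w => w ^ 2) w) := by
  have hind : 0 ≤ {w | L < w}.indicator (fun w : ℝ => w ^ 2) w :=
    Set.indicator_nonneg (fun w _ => sq_nonneg w) w
  have hcube : |u| * ‖Complex.exp ((τ * d : ℝ) * Complex.I) - 1 - (τ * d : ℝ) * Complex.I‖ ≤
      2 * τ ^ 2 * (|α| + 2 * |β|) ^ 3 := by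
    calc _ ≤ (|α| + 2 * |β|) * (2 * (τ * d) ^ 2) := by
          gcongr; exact norm_exp_ofReal_mul_I_sub_one_sub_le_two_mul_sq _
      _ = (|α| + 2 * |β|) * (2 * τ ^ 2 * |d| ^ 2) := by rw [sq_abs]; ring
      _ ≤ (|α| + 2 * |β|) * (2 * τ ^ 2 * (|α| + 2 * |β|) ^ 2) := by gcongr
      _ = _ := by ring
  rcases le_total |α| (2 * |β|) with h | h
  · calc _ ≤ 2 * τ ^ 2 * (4 * |β|) ^ 3 := hcube.trans (by gcongr; linarith)
      _ = 128 * τ ^ 2 * |β| ^ 3 := by ring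
      _ ≤ _ := le_add_of_nonneg_right (by positivity)
  have hdouble : |α| + 2 * |β| ≤ 2 * (C * w) := by linarith
  refine le_trans ?_ (le_add_of_nonneg_left (by positivity))
  by_cases hwL : L < w
  · rw [Set.indicator_of_mem (Set.mem_ofPred.2 hwL)]
    calc _ ≤ 2 * (C * w) * (2 * (|τ| * (2 * (C * w)))) := by
          gcongr
          · exact hu.trans hdouble
          · refine (norm_exp_ofReal_mul_I_sub_one_sub_le _).trans ?_
            rw [abs_mul]
            gcongr
            exact hd.trans hdouble
      _ = 8 * C ^ 2 * |τ| * w ^ 2 := by ring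
      _ ≤ _ := by gcongr; exact le_add_of_nonneg_left (by positivity)
  · calc _ ≤ 2 * |τ| ^ 2 * (2 * (C * w)) ^ 3 := hcube.trans (by rw [sq_abs]; gcongr)
      _ = 8 * C ^ 2 * |τ| * (2 * C * w * |τ| * w ^ 2) := by ring
      _ ≤ 8 * C ^ 2 * |τ| * (2 * C * L * |τ| * w ^ 2) := by gcongr; exact not_lt.1 hwL
      _ ≤ _ := by gcongr; exact le_add_of_nonneg_right hind

/-- Grönwall's argument: multiply by the integrating factor `exp (V τ² / 2)`. -/
lemma norm_sub_exp_neg_le_of_norm_deriv_add_le {φ φ' : ℝ → ℂ} {V η t : ℝ} (hV : 0 ≤ V)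
    (ht : 0 ≤ t) (hφ : ∀ τ, HasDerivAt φ (φ' τ) τ) (h0 : φ 0 = 1)
    (h : ∀ τ ∈ Set.Ico 0 t, ‖φ' τ + τ * V * φ τ‖ ≤ η) :
    ‖φ t - Real.exp (-(t ^ 2 * V) / 2)‖ ≤ η * t := by
  have hE (τ : ℝ) : HasDerivAt (fun τ : ℝ => ((Real.exp (V * τ ^ 2 / 2) : ℝ) : ℂ))
      ((Real.exp (V * τ ^ 2 / 2) * (V * τ) : ℝ) : ℂ) τ := by
    have : HasDerivAt (fun τ : ℝ => V * τ ^ 2 / 2) (V * τ) τ :=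
      (((hasDerivAt_pow 2 τ).const_mul V).div_const 2).congr_deriv (by norm_num; ring)
    exact this.exp.ofReal_comp
  have hderiv (τ : ℝ) (hτ : τ ∈ Set.Ico 0 t) :
      ‖φ' τ * (Real.exp (V * τ ^ 2 / 2) : ℝ) + φ τ * (Real.exp (V * τ ^ 2 / 2) * (V * τ) : ℝ)‖ ≤
        η * Real.exp (V * t ^ 2 / 2) := by
    have e : φ' τ * (Real.exp (V * τ ^ 2 / 2) : ℝ) +
        φ τ * (Real.exp (V * τ ^ 2 / 2) * (V * τ) : ℝ) =
        (φ' τ + τ * V * φ τ) * (Real.exp (V * τ ^ 2 / 2) : ℝ) := by push_cast; ring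
    rw [e, norm_mul, Complex.norm_real, Real.norm_eq_abs, Real.abs_exp]
    exact mul_le_mul (h τ hτ) (Real.exp_le_exp.2 (by gcongr; exacts [hτ.1, hτ.2.le]))
      (Real.exp_pos _).le ((norm_nonneg _).trans (h τ hτ))
  have key := norm_image_sub_le_of_norm_deriv_le_segment'
    (fun τ _ => ((hφ τ).mul (hE τ)).hasDerivWithinAt) hderiv t (Set.right_mem_Icc.2 ht)
  have e : φ t - Real.exp (-(t ^ 2 * V) / 2) =
      (φ t * (Real.exp (V * t ^ 2 / 2) : ℝ) - 1) * (Real.exp (-(t ^ 2 * V) / 2) : ℝ) := by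
    rw [sub_mul, mul_assoc, ← Complex.ofReal_mul, ← Real.exp_add]
    ring_nf
    simp
  rw [e, norm_mul, Complex.norm_real, Real.norm_eq_abs, Real.abs_exp]
  calc _ ≤ η * Real.exp (V * t ^ 2 / 2) * t * Real.exp (-(t ^ 2 * V) / 2) := by
        gcongr; simpa [h0] using key
    _ = η * t * (Real.exp (V * t ^ 2 / 2) * Real.exp (-(t ^ 2 * V) / 2)) := by ring
    _ = η * t := by rw [← Real.exp_add]; ring_nf; simp

end Exponential

section Independence

variable {Ω : Type*} [MeasurableSpace Ω] {P : Measure Ω} [IsProbabilityMeasure P]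
  {E : Type*} [NormedAddCommGroup E]

section

variable {α β : Type*} [MeasurableSpace α] [MeasurableSpace β] {X : Ω → α} {Y : Ω → β}

lemma integral_eq_integral_integral_of_indepFun [NormedSpace ℝ E] (hXY : IndepFun X Y P)
    (hX : Measurable X) (hY : Measurable Y) {F : α × β → E} (hF : StronglyMeasurable F)
    (hint : Integrable (fun ω => F (X ω, Y ω)) P) :
    ∫ ω, F (X ω, Y ω) ∂P = ∫ ω, ∫ ω', F (X ω', Y ω) ∂P ∂P := by
  have hlaw : P.map (fun ω => (X ω, Y ω)) = (P.map X).prod (P.map Y) :=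
    (indepFun_iff_map_prod_eq_prod_map_map hX.aemeasurable hY.aemeasurable).1 hXY
  have hXYm : AEMeasurable (fun ω => (X ω, Y ω)) P := (hX.prodMk hY).aemeasurable
  have hint' : Integrable F ((P.map X).prod (P.map Y)) := by
    rw [← hlaw]; exact (integrable_map_measure hF.aestronglyMeasurable hXYm).2 hint
  have : IsProbabilityMeasure (P.map X) := Measure.isProbabilityMeasure_map hX.aemeasurable
  have : IsProbabilityMeasure (P.map Y) := Measure.isProbabilityMeasure_map hY.aemeasurable
  rw [← integral_map hXYm hF.aestronglyMeasurable, hlaw, integral_prod_symm _ hint',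
    integral_map hY.aemeasurable hF.integral_prod_left'.aestronglyMeasurable]
  refine integral_congr_ae (.of_forall fun ω => ?_)
  exact integral_map hX.aemeasurable
    (hF.comp_measurable measurable_prodMk_right).aestronglyMeasurable

end

section

variable {ι : Type*} [Finite ι] [DecidableEq ι] {β : ι → Type*} [∀ i, MeasurableSpace (β i)]
  {z : ∀ i, Ω → β i}

lemma integral_eq_integral_integral_update [NormedSpace ℝ E] (hz : iIndepFun z P)
    (hzm : ∀ i, Measurable (z i)) {F : (∀ i, β i) → E} (hF : StronglyMeasurable F)
    (hint : Integrable (fun ω => F fun i => z i ω) P) (k : ι) :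
    ∫ ω, F (fun i => z i ω) ∂P =
      ∫ ω, ∫ ω', F (Function.update (fun i => z i ω) k (z k ω')) ∂P ∂P := by
  have := Fintype.ofFinite ι
  have hind : IndepFun (z k) (fun ω (i : ({k}ᶜ : Finset ι)) => z i ω) P :=
    (hz.indepFun_finset {k} {k}ᶜ disjoint_compl_right hzm).comp
      (φ := fun x : (∀ i : ({k} : Finset ι), β i) => x ⟨k, Finset.mem_singleton_self k⟩)
      (measurable_pi_apply _) measurable_id
  let glue (p : β k × (∀ i : ({k}ᶜ : Finset ι), β i)) (i : ι) : β i :=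
    if h : i = k then h ▸ p.1 else p.2 ⟨i, by simpa using h⟩
  have hglue : Measurable glue := by
    refine measurable_pi_lambda _ fun i => ?_
    by_cases h : i = k
    · subst h; simpa [glue] using measurable_fst
    · simp only [glue, h, dite_false]
      exact (measurable_pi_apply (⟨i, by simpa using h⟩ : ({k}ᶜ : Finset ι))).comp measurable_snd
  have hupd (x : β k) (w : ∀ i, β i) : glue (x, fun i => w i) = Function.update w k x := by
    funext i
    by_cases h : i = k
    · subst h; simp [glue]
    · simp [glue, h]
  have hself (ω : Ω) : glue (z k ω, fun i => z i ω) = fun i => z i ω := by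
    rw [hupd (z k ω) fun i => z i ω, Function.update_eq_self]
  have key := integral_eq_integral_integral_of_indepFun hind (hzm k)
    (measurable_pi_lambda _ fun i => hzm i) (hF.comp_measurable hglue)
    (by simpa only [Function.comp_apply, hself] using hint)
  simpa only [Function.comp_apply, hself, fun ω ω' => hupd (z k ω') fun i => z i ω] using key

end

end Independence

section Matrix

open scoped Matrix Matrix.Norms.L2Operator

variable {ι : Type*}

/-- The matrix `A` with its diagonal entries replaced by `0`. -/
def offDiagPart [DecidableEq ι] (A : Matrix ι ι ℝ) : Matrix ι ι ℝ :=
  A - Matrix.diagonal A.diag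

lemma offDiagPart_apply_self [DecidableEq ι] (A : Matrix ι ι ℝ) (k : ι) :
    offDiagPart A k k = 0 := by
  simp [offDiagPart]

lemma offDiagPart_isSymm [DecidableEq ι] {A : Matrix ι ι ℝ} (hA : A.IsSymm) :
    (offDiagPart A).IsSymm :=
  hA.sub (Matrix.isSymm_diagonal _)

variable [Fintype ι]

/-- The quadratic form `xᵀ A x - Tr A`, centred for vectors `x` with standardized independent
entries. -/
def centredQuadForm (A : Matrix ι ι ℝ) (x : ι → ℝ) : ℝ :=
  x ⬝ᵥ A *ᵥ x - A.trace

/-- The variance of `centredQuadForm A` at a vector with independent standardized entries of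
fourth cumulants `κ`, when `A` is symmetric. -/
def quadFormVariance (κ : ι → ℝ) (A : Matrix ι ι ℝ) : ℝ :=
  ∑ i, A i i ^ 2 * κ i + 2 * (Aᵀ * A).trace

lemma trace_transpose_mul_self_eq_sum (A : Matrix ι ι ℝ) :
    (Aᵀ * A).trace = ∑ i, ∑ j, A i j ^ 2 := by
  rw [Finset.sum_comm]
  simp only [Matrix.trace, Matrix.diag_apply, Matrix.mul_apply, Matrix.transpose_apply, sq]

variable [DecidableEq ι] {A : Matrix ι ι ℝ}

lemma mulVec_apply_eq_diag_add_offDiagPart (A : Matrix ι ι ℝ) (x : ι → ℝ) (k : ι) :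
    (A *ᵥ x) k = A k k * x k + (offDiagPart A *ᵥ x) k := by
  simp [offDiagPart, Matrix.sub_mulVec, Matrix.mulVec_diagonal]

lemma offDiagPart_mulVec_update (A : Matrix ι ι ℝ) (x : ι → ℝ) (k : ι) (c : ℝ) :
    (offDiagPart A *ᵥ Function.update x k c) k = (offDiagPart A *ᵥ x) k := by
  refine Finset.sum_congr rfl fun j _ => ?_
  by_cases h : j = k
  · simp [h, offDiagPart_apply_self]
  · rw [Function.update_of_ne h]

lemma centredQuadForm_eq_sum (A : Matrix ι ι ℝ) (x : ι → ℝ) :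
    centredQuadForm A x = ∑ k, (A k k * (x k ^ 2 - 1) + (offDiagPart A *ᵥ x) k * x k) := by
  simp only [centredQuadForm, dotProduct, Matrix.trace, Matrix.diag_apply,
    ← Finset.sum_sub_distrib]
  exact Finset.sum_congr rfl fun k _ => by rw [mulVec_apply_eq_diag_add_offDiagPart]; ring

lemma centredQuadForm_update (hA : A.IsSymm) (x : ι → ℝ) (k : ι) (c : ℝ) :
    centredQuadForm A (Function.update x k c) =
      centredQuadForm A (Function.update x k 0) + A k k +
        (A k k * (c ^ 2 - 1) + 2 * (offDiagPart A *ᵥ x) k * c) := by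
  set u := Function.update x k 0 with hu
  have hsplit : Function.update x k c = u + Pi.single k c := by
    funext i
    by_cases h : i = k
    · subst h; simp [hu]
    · simp [hu, h]
  have hAu : (A *ᵥ u) k = (offDiagPart A *ᵥ x) k := by
    rw [mulVec_apply_eq_diag_add_offDiagPart, hu, offDiagPart_mulVec_update]
    simp
  have hcross : u ⬝ᵥ A *ᵥ Pi.single k c = c * (offDiagPart A *ᵥ x) k := by
    rw [Matrix.dotProduct_mulVec, ← Matrix.mulVec_transpose, hA, dotProduct_single, hAu, mul_comm]
  have hdiag : (A *ᵥ Pi.single k c) k = A k k * c := by simp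
  simp only [centredQuadForm, hsplit, Matrix.mulVec_add, dotProduct_add, add_dotProduct,
    single_dotProduct, hcross, hAu, hdiag]
  ring

lemma sum_sq_mulVec_le (A : Matrix ι ι ℝ) (x : ι → ℝ) :
    ∑ i, (A *ᵥ x) i ^ 2 ≤ ‖A‖ ^ 2 * ∑ i, x i ^ 2 := by
  have h := pow_le_pow_left₀ (norm_nonneg _) (A.l2_opNorm_mulVec (WithLp.toLp 2 x)) 2
  rw [mul_pow, EuclideanSpace.norm_sq_eq, EuclideanSpace.norm_sq_eq] at h
  simpa using h

lemma sum_sq_col_le (A : Matrix ι ι ℝ) (j : ι) : ∑ i, A i j ^ 2 ≤ ‖A‖ ^ 2 := by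
  simpa [Pi.single_apply] using sum_sq_mulVec_le A (Pi.single j 1)

lemma abs_apply_le_norm (A : Matrix ι ι ℝ) (i j : ι) : |A i j| ≤ ‖A‖ :=
  abs_le_of_sq_le_sq ((Finset.single_le_sum (fun i _ => sq_nonneg (A i j))
    (Finset.mem_univ i)).trans (sum_sq_col_le A j)) (norm_nonneg A)

lemma trace_transpose_mul_self_le (A : Matrix ι ι ℝ) :
    (Aᵀ * A).trace ≤ Fintype.card ι * ‖A‖ ^ 2 := by
  rw [trace_transpose_mul_self_eq_sum, Finset.sum_comm]
  simpa using Finset.sum_le_card_nsmul Finset.univ _ _ fun j _ => sum_sq_col_le A j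

lemma norm_offDiagPart_le (A : Matrix ι ι ℝ) : ‖offDiagPart A‖ ≤ 2 * ‖A‖ := by
  have hdiag : ‖Matrix.diagonal A.diag‖ ≤ ‖A‖ := by
    rw [Matrix.l2_opNorm_diagonal]
    exact (pi_norm_le_iff_of_nonneg (norm_nonneg A)).2 fun i => abs_apply_le_norm A i i
  calc ‖A - Matrix.diagonal A.diag‖ ≤ ‖A‖ + ‖A‖ := (norm_sub_le _ _).trans (by gcongr)
    _ = 2 * ‖A‖ := (two_mul _).symm

lemma sum_sq_offDiagPart_row_le (hA : A.IsSymm) (k : ι) :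
    ∑ j, offDiagPart A k j ^ 2 ≤ (2 * ‖A‖) ^ 2 := by
  calc ∑ j, offDiagPart A k j ^ 2 = ∑ j, offDiagPart A j k ^ 2 :=
        Finset.sum_congr rfl fun j _ => by rw [(offDiagPart_isSymm hA).apply]
    _ ≤ ‖offDiagPart A‖ ^ 2 := sum_sq_col_le _ k
    _ ≤ (2 * ‖A‖) ^ 2 := by gcongr; exact norm_offDiagPart_le A

lemma sum_sq_transpose_offDiagPart_mulVec_le (hA : A.IsSymm) {v : ι → ℝ} {C K : ℝ}
    (hC : ‖A‖ ≤ C) (hv : ∀ k, |v k| ≤ K) :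
    ∑ j, ((offDiagPart A)ᵀ *ᵥ v) j ^ 2 ≤ Fintype.card ι * (2 * C * K) ^ 2 := by
  have hv2 : ∑ k, v k ^ 2 ≤ Fintype.card ι * K ^ 2 := by
    simpa using Finset.sum_le_card_nsmul Finset.univ (fun k => v k ^ 2) (K ^ 2) fun k _ => by
      rw [← sq_abs]
      gcongr
      exact hv k
  have hO : ‖offDiagPart A‖ ≤ 2 * C := (norm_offDiagPart_le A).trans (by gcongr)
  calc ∑ j, ((offDiagPart A)ᵀ *ᵥ v) j ^ 2 ≤ ‖offDiagPart A‖ ^ 2 * ∑ k, v k ^ 2 := by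
        rw [offDiagPart_isSymm hA]; exact sum_sq_mulVec_le _ v
    _ ≤ (2 * C) ^ 2 * (Fintype.card ι * K ^ 2) := by gcongr
    _ = Fintype.card ι * (2 * C * K) ^ 2 := by ring

lemma norm_transpose_mul_self_offDiagPart_le (hA : A.IsSymm) {C : ℝ} (hC : ‖A‖ ≤ C) :
    ‖(offDiagPart A)ᵀ * offDiagPart A‖ ≤ (2 * C) ^ 2 := by
  have hO : ‖offDiagPart A‖ ≤ 2 * C := (norm_offDiagPart_le A).trans (by gcongr)
  have hC0 : 0 ≤ C := (norm_nonneg A).trans hC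
  rw [offDiagPart_isSymm hA, sq]
  exact (norm_mul_le _ _).trans (by gcongr)

lemma trace_transpose_mul_self_eq_diag_add_offDiagPart (A : Matrix ι ι ℝ) :
    (Aᵀ * A).trace = ∑ k, A k k ^ 2 + ∑ k, ∑ j, offDiagPart A k j ^ 2 := by
  rw [trace_transpose_mul_self_eq_sum, ← Finset.sum_add_distrib]
  refine Finset.sum_congr rfl fun k _ => ?_
  have h (j : ι) : A k j ^ 2 = (if k = j then A k k ^ 2 else 0) + offDiagPart A k j ^ 2 := by
    by_cases hkj : k = j
    · subst hkj; simp [offDiagPart]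
    · simp [offDiagPart, hkj]
  rw [Finset.sum_congr rfl fun j _ => h j, Finset.sum_add_distrib, Finset.sum_ite_eq,
    if_pos (Finset.mem_univ k)]

omit [DecidableEq ι] in
lemma quadFormVariance_le {κ : ι → ℝ} {m : ℝ} (hm : 1 ≤ m) (hκ : ∀ i, κ i ≤ m - 3)
    (A : Matrix ι ι ℝ) : quadFormVariance κ A ≤ 2 * m * (Aᵀ * A).trace := by
  classical
  have hoff : 0 ≤ ∑ k, ∑ j, offDiagPart A k j ^ 2 := by positivity
  have hdiag : ∑ k, A k k ^ 2 * κ k ≤ (∑ k, A k k ^ 2) * (m - 3) := by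
    rw [Finset.sum_mul]; gcongr; exact hκ _
  have : 0 ≤ ∑ k, A k k ^ 2 := by positivity
  rw [quadFormVariance, trace_transpose_mul_self_eq_diag_add_offDiagPart]
  nlinarith

end Matrix

section Standardized

variable {Ω : Type*} [MeasurableSpace Ω] {P : Measure Ω}

/-- `X` is a random variable with mean `0`, variance `1` and fourth moment at most `m`. -/
structure IsStandardized (X : Ω → ℝ) (P : Measure Ω) (m : ℝ) : Prop where
  measurable : Measurable X
  memLp : MemLp X 4 P
  mean : ∫ ω, X ω ∂P = 0
  sq : ∫ ω, X ω ^ 2 ∂P = 1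
  fourth : ∫ ω, X ω ^ 4 ∂P ≤ m

/-- The truncated second moment of `X² - 1` entering Lindeberg's condition. -/
noncomputable def lindebergTail (P : Measure Ω) (X : Ω → ℝ) (L : ℝ) : ℝ :=
  ∫ ω in {ω | L < |(|X ω| ^ 2 - 1)|}, |(|X ω| ^ 2 - 1)| ^ 2 ∂P

/-- The covariance of `a (X² - 1) + h X` and `a (X² - 1) + 2 h X` for a standardized `X`: the two
factors are a summand of a centred quadratic form and its increment in one coordinate. -/
noncomputable def siteCov (P : Measure Ω) (X : Ω → ℝ) (a h : ℝ) : ℝ :=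
  a ^ 2 * (∫ ω, X ω ^ 4 ∂P - 1) + 3 * a * h * ∫ ω, X ω ^ 3 ∂P + 2 * h ^ 2

lemma IsStandardized.of_variance {X : Ω → ℝ} {m : ℝ} (hmeas : Measurable X)
    (hmemLp : MemLp X 4 P) (hmean : ∫ ω, X ω ∂P = 0) (hvar : variance X P = 1)
    (hfour : ∫ ω, |X ω| ^ 4 ∂P ≤ m) : IsStandardized X P m where
  measurable := hmeas
  memLp := hmemLp
  mean := hmean
  sq := by rwa [variance_of_integral_eq_zero hmeas.aemeasurable hmean] at hvar
  fourth := by simpa only [(by decide : Even 4).pow_abs] using hfour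

variable [IsProbabilityMeasure P]

lemma integrable_pow_of_memLp {X : Ω → ℝ} {n k : ℕ} (hX : MemLp X n P) (hk : k ≤ n) :
    Integrable (fun ω => X ω ^ k) P := by
  have hXk : MemLp X k P := hX.mono_exponent (by exact_mod_cast hk)
  refine (integrable_norm_iff (hX.aestronglyMeasurable.pow k)).1 ?_
  simpa using hXk.integrable_norm_pow'

lemma norm_integral_sub_mul_exp_le {U D : Ω → ℝ} (hU : Integrable U P) (hD : Integrable D P)
    (hUD : Integrable (fun ω => U ω * D ω) P) (hU0 : ∫ ω, U ω ∂P = 0) (τ : ℝ) :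
    ‖∫ ω, ((U ω : ℂ) - τ * (∫ ω', U ω' * D ω' ∂P : ℝ) * Complex.I) *
      Complex.exp ((τ * D ω : ℝ) * Complex.I) ∂P‖ ≤
      ∫ ω, |U ω| * ‖Complex.exp ((τ * D ω : ℝ) * Complex.I) - 1 - (τ * D ω : ℝ) * Complex.I‖ ∂P +
        τ ^ 2 * |∫ ω, U ω * D ω ∂P| * ∫ ω, |D ω| ∂P := by
  set c := ∫ ω, U ω * D ω ∂P with hc
  have hDm := hD.aestronglyMeasurable.aemeasurable
  have hexp : AEStronglyMeasurable (fun ω => Complex.exp ((τ * D ω : ℝ) * Complex.I)) P :=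
    (by fun_prop : AEMeasurable _ P).aestronglyMeasurable
  have hlini : Integrable (fun ω => (U ω : ℂ) + τ * Complex.I * (U ω * D ω - c : ℝ)) P :=
    hU.ofReal.add ((hUD.sub (integrable_const c)).ofReal.const_mul _)
  have hlin : ∫ ω, ((U ω : ℂ) + τ * Complex.I * (U ω * D ω - c : ℝ)) ∂P = 0 := by
    rw [integral_add hU.ofReal ((hUD.sub (integrable_const c)).ofReal.const_mul _),
      integral_const_mul, integral_complex_ofReal, integral_complex_ofReal,
      integral_sub hUD (integrable_const c), hU0]
    simp [hc]
  have hUi : Integrable (fun ω => ((U ω : ℂ) - τ * c * Complex.I) *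
      Complex.exp ((τ * D ω : ℝ) * Complex.I)) P :=
    (hU.ofReal.sub (integrable_const _) : Integrable (fun ω => (U ω : ℂ) - τ * c * Complex.I) P)
      |>.mul_bdd (c := 1) hexp (.of_forall fun ω => (Complex.norm_exp_ofReal_mul_I _).le)
  have hg : Integrable (fun ω => |U ω| *
      ‖Complex.exp ((τ * D ω : ℝ) * Complex.I) - 1 - (τ * D ω : ℝ) * Complex.I‖) P := by
    refine (hUD.abs.const_mul (2 * |τ|)).mono' ?_ (.of_forall fun ω => ?_)
    · exact hU.abs.aestronglyMeasurable.mul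
        ((hexp.sub aestronglyMeasurable_const).sub (by fun_prop)).norm
    · rw [Real.norm_of_nonneg (by positivity), abs_mul]
      calc _ ≤ |U ω| * (2 * |τ * D ω|) := by
            gcongr; exact norm_exp_ofReal_mul_I_sub_one_sub_le _
        _ = 2 * |τ| * (|U ω| * |D ω|) := by rw [abs_mul]; ring
  rw [← sub_zero (∫ ω, _ ∂P), ← hlin, ← integral_sub hUi hlini, ← integral_const_mul,
    ← integral_add hg (hD.abs.const_mul _)]
  exact norm_integral_le_of_norm_le (hg.add (hD.abs.const_mul _))
    (.of_forall fun ω => norm_sub_mul_exp_sub_linear_le (U ω) (D ω) c τ)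

namespace IsStandardized

variable {X : Ω → ℝ} {m : ℝ}

section

variable (hX : IsStandardized X P m)
include hX

lemma integrable_pow {k : ℕ} (hk : k ≤ 4) : Integrable (fun ω => X ω ^ k) P :=
  integrable_pow_of_memLp hX.memLp hk

lemma integrable : Integrable X P := by
  simpa using hX.integrable_pow (k := 1) (by norm_num)

lemma integrable_quartic (c₀ c₁ c₂ c₃ c₄ : ℝ) :
    Integrable (fun ω => c₀ + c₁ * X ω + c₂ * X ω ^ 2 + c₃ * X ω ^ 3 + c₄ * X ω ^ 4) P :=
  ((((integrable_const c₀).add (hX.integrable.const_mul c₁)).add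
    ((hX.integrable_pow (by norm_num)).const_mul c₂)).add
    ((hX.integrable_pow (by norm_num)).const_mul c₃)).add
    ((hX.integrable_pow (by norm_num)).const_mul c₄)

lemma integral_quartic (c₀ c₁ c₂ c₃ c₄ : ℝ) :
    ∫ ω, (c₀ + c₁ * X ω + c₂ * X ω ^ 2 + c₃ * X ω ^ 3 + c₄ * X ω ^ 4) ∂P =
      c₀ + c₂ + c₃ * ∫ ω, X ω ^ 3 ∂P + c₄ * ∫ ω, X ω ^ 4 ∂P := by
  have h1 := hX.integrable.const_mul c₁
  have h2 := (hX.integrable_pow (k := 2) (by norm_num)).const_mul c₂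
  have h3 := (hX.integrable_pow (k := 3) (by norm_num)).const_mul c₃
  have h4 := (hX.integrable_pow (k := 4) (by norm_num)).const_mul c₄
  rw [integral_add ((((integrable_const c₀).fun_add h1).fun_add h2).fun_add h3) h4,
    integral_add (((integrable_const c₀).fun_add h1).fun_add h2) h3,
    integral_add ((integrable_const c₀).fun_add h1) h2, integral_add (integrable_const c₀) h1]
  simp only [integral_const, integral_const_mul, hX.mean, hX.sq]
  simp

lemma one_le_integral_pow_four : 1 ≤ ∫ ω, X ω ^ 4 ∂P := by
  have h := hX.integral_quartic 1 0 (-2) 0 1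
  have h0 : 0 ≤ ∫ ω, (1 + 0 * X ω + -2 * X ω ^ 2 + 0 * X ω ^ 3 + 1 * X ω ^ 4) ∂P :=
    integral_nonneg fun ω => by
      change 0 ≤ _
      nlinarith [sq_nonneg (X ω ^ 2 - 1)]
  linarith

lemma one_le : 1 ≤ m :=
  hX.one_le_integral_pow_four.trans hX.fourth

lemma integral_abs_cube_le : ∫ ω, |X ω| ^ 3 ∂P ≤ m := by
  have hle (ω : Ω) : |X ω| ^ 3 ≤
      0 + 0 * X ω + 1 / 2 * X ω ^ 2 + 0 * X ω ^ 3 + 1 / 2 * X ω ^ 4 := by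
    have h2 := sq_abs (X ω)
    have h4 := (by decide : Even 4).pow_abs (X ω)
    rw [← h2, ← h4]
    nlinarith [mul_nonneg (sq_nonneg |X ω|) (sq_nonneg (|X ω| - 1))]
  have h := integral_mono_of_nonneg (.of_forall fun ω => by positivity)
    (hX.integrable_quartic 0 0 (1 / 2) 0 (1 / 2)) (.of_forall hle)
  rw [hX.integral_quartic] at h
  linarith [hX.fourth, hX.one_le]

lemma abs_integral_cube_le : |∫ ω, X ω ^ 3 ∂P| ≤ m :=
  (abs_integral_le_integral_abs).trans (by simpa only [abs_pow] using hX.integral_abs_cube_le)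

lemma integral_abs_le_one : ∫ ω, |X ω| ∂P ≤ 1 := by
  have hle (ω : Ω) : |X ω| ≤
      1 / 2 + 0 * X ω + 1 / 2 * X ω ^ 2 + 0 * X ω ^ 3 + 0 * X ω ^ 4 := by
    rw [← sq_abs (X ω)]
    nlinarith [sq_nonneg (|X ω| - 1)]
  have h := integral_mono hX.integrable.abs (hX.integrable_quartic (1 / 2) 0 (1 / 2) 0 0) hle
  rw [hX.integral_quartic] at h
  linarith

lemma integrable_sq_sub_one_sq : Integrable (fun ω => |(|X ω| ^ 2 - 1)| ^ 2) P :=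
  (hX.integrable_quartic 1 0 (-2) 0 1).congr (.of_forall fun ω => by
    simp only [sq_abs]; ring)

lemma integral_sq_sub_one_sq_le : ∫ ω, |(|X ω| ^ 2 - 1)| ^ 2 ∂P ≤ m := by
  have h := hX.integral_quartic 1 0 (-2) 0 1
  calc ∫ ω, |(|X ω| ^ 2 - 1)| ^ 2 ∂P = 1 + -2 + 0 * ∫ ω, X ω ^ 3 ∂P + 1 * ∫ ω, X ω ^ 4 ∂P := by
        rw [← h]; congr 1; funext ω; simp only [sq_abs]; ring
    _ ≤ m := by linarith [hX.fourth]

lemma integrable_site (a h : ℝ) : Integrable (fun ω => a * (X ω ^ 2 - 1) + h * X ω) P :=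
  (hX.integrable_quartic (-a) h a 0 0).congr (.of_forall fun ω => by ring)

lemma integral_site (a h : ℝ) : ∫ ω, (a * (X ω ^ 2 - 1) + h * X ω) ∂P = 0 := by
  have e := hX.integral_quartic (-a) h a 0 0
  rw [show -a + a + 0 * ∫ ω, X ω ^ 3 ∂P + 0 * ∫ ω, X ω ^ 4 ∂P = 0 by ring] at e
  rw [← e]; congr 1; funext ω; ring

lemma integrable_site_mul_increment (a h : ℝ) : Integrable
    (fun ω => (a * (X ω ^ 2 - 1) + h * X ω) * (a * (X ω ^ 2 - 1) + 2 * h * X ω)) P :=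
  (hX.integrable_quartic (a ^ 2) (-3 * a * h) (-2 * a ^ 2 + 2 * h ^ 2) (3 * a * h) (a ^ 2)).congr
    (.of_forall fun ω => by ring)

lemma integral_site_mul_increment (a h : ℝ) :
    ∫ ω, (a * (X ω ^ 2 - 1) + h * X ω) * (a * (X ω ^ 2 - 1) + 2 * h * X ω) ∂P =
      siteCov P X a h := by
  have e := hX.integral_quartic (a ^ 2) (-3 * a * h) (-2 * a ^ 2 + 2 * h ^ 2) (3 * a * h) (a ^ 2)
  calc _ = ∫ ω, (a ^ 2 + -3 * a * h * X ω + (-2 * a ^ 2 + 2 * h ^ 2) * X ω ^ 2 +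
        3 * a * h * X ω ^ 3 + a ^ 2 * X ω ^ 4) ∂P := by congr 1; funext ω; ring
    _ = siteCov P X a h := by rw [e, siteCov]; ring

lemma abs_siteCov_le {a C : ℝ} (ha : |a| ≤ C) (h : ℝ) :
    |siteCov P X a h| ≤ m * ((C + |h|) * (C + 2 * |h|)) := by
  have h4 : |∫ ω, X ω ^ 4 ∂P - 1| ≤ m := by
    rw [abs_of_nonneg (by linarith [hX.one_le_integral_pow_four])]
    linarith [hX.fourth]
  have hC : 0 ≤ C := (abs_nonneg a).trans ha
  have : 0 ≤ m := zero_le_one.trans hX.one_le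
  calc |siteCov P X a h|
      ≤ |a ^ 2 * (∫ ω, X ω ^ 4 ∂P - 1)| + |3 * a * h * ∫ ω, X ω ^ 3 ∂P| + |2 * h ^ 2| :=
        abs_add_three _ _ _
    _ = |a| ^ 2 * |∫ ω, X ω ^ 4 ∂P - 1| + 3 * |a| * |h| * |∫ ω, X ω ^ 3 ∂P| + 2 * |h| ^ 2 := by
        simp only [abs_mul, abs_pow, Nat.abs_ofNat]
    _ ≤ C ^ 2 * m + 3 * C * |h| * m + 2 * |h| ^ 2 * m := by
        refine add_le_add (add_le_add ?_ ?_) ?_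
        · gcongr
        · gcongr
          exact hX.abs_integral_cube_le
        · nlinarith [sq_nonneg |h|, hX.one_le]
    _ = m * ((C + |h|) * (C + 2 * |h|)) := by ring

lemma integral_abs_increment_le {a C : ℝ} (ha : |a| ≤ C) (h : ℝ) :
    ∫ ω, |a * (X ω ^ 2 - 1) + 2 * h * X ω| ∂P ≤ 2 * (C + |h|) := by
  have hC : 0 ≤ C := (abs_nonneg a).trans ha
  have hsq := hX.integrable_pow (k := 2) (by norm_num)
  have hsq1 := hsq.fun_add (integrable_const (1 : ℝ))
  have hle (ω : Ω) : |a * (X ω ^ 2 - 1) + 2 * h * X ω| ≤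
      C * (X ω ^ 2 + 1) + 2 * |h| * |X ω| := by
    calc _ ≤ |a| * |X ω ^ 2 - 1| + |2 * h * X ω| := (abs_add_le _ _).trans_eq (by rw [abs_mul])
      _ ≤ C * (X ω ^ 2 + 1) + 2 * |h| * |X ω| := by
        rw [abs_mul, abs_mul, Nat.abs_ofNat]
        gcongr
        exact abs_le.2 ⟨by nlinarith [sq_nonneg (X ω)], by linarith⟩
  have hi : Integrable (fun ω => C * (X ω ^ 2 + 1) + 2 * |h| * |X ω|) P :=
    (hsq1.const_mul C).add (hX.integrable.abs.const_mul _)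
  refine (integral_mono_of_nonneg (.of_forall fun ω => abs_nonneg _) hi (.of_forall hle)).trans ?_
  rw [integral_add (hsq1.const_mul C) (hX.integrable.abs.const_mul _),
    integral_const_mul, integral_const_mul, integral_add hsq (integrable_const 1), hX.sq]
  simp only [integral_const, probReal_univ, smul_eq_mul, mul_one]
  nlinarith [mul_le_mul_of_nonneg_left hX.integral_abs_le_one (abs_nonneg h)]

lemma integral_abs_site_mul_norm_exp_sub_le {a C L : ℝ} (ha : |a| ≤ C) (hL : 0 ≤ L) (h τ : ℝ) :
    ∫ ω, |a * (X ω ^ 2 - 1) + h * X ω| *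
      ‖Complex.exp ((τ * (a * (X ω ^ 2 - 1) + 2 * h * X ω) : ℝ) * Complex.I) - 1 -
        (τ * (a * (X ω ^ 2 - 1) + 2 * h * X ω) : ℝ) * Complex.I‖ ∂P ≤
      128 * τ ^ 2 * |h| ^ 3 * m +
        8 * C ^ 2 * |τ| * (2 * C * L * |τ| * m + lindebergTail P X L) := by
  have hC : 0 ≤ C := (abs_nonneg a).trans ha
  set w : Ω → ℝ := fun ω => |(|X ω| ^ 2 - 1)| with hw
  have hset : MeasurableSet {ω | L < w ω} :=
    measurableSet_lt measurable_const (by have := hX.measurable; fun_prop)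
  have hcube : Integrable (fun ω => |X ω| ^ 3) P := by
    simpa only [abs_pow] using (hX.integrable_pow (k := 3) (by norm_num)).abs
  have hcube' := hcube.const_mul (128 * τ ^ 2 * |h| ^ 3)
  have hw2 := hX.integrable_sq_sub_one_sq.const_mul (2 * C * L * |τ|)
  have hwL := hX.integrable_sq_sub_one_sq.indicator hset
  have htail : lindebergTail P X L =
      ∫ ω, {ω | L < w ω}.indicator (fun ω => w ω ^ 2) ω ∂P := (integral_indicator hset).symm
  calc _ ≤ ∫ ω, (128 * τ ^ 2 * |h| ^ 3 * |X ω| ^ 3 + 8 * C ^ 2 * |τ| *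
        (2 * C * L * |τ| * w ω ^ 2 + {ω | L < w ω}.indicator (fun ω => w ω ^ 2) ω)) ∂P := by
        refine integral_mono_of_nonneg (.of_forall fun ω => by positivity)
          (hcube'.add ((hw2.add hwL).const_mul _)) (.of_forall fun ω => ?_)
        have hα : |a * (X ω ^ 2 - 1)| ≤ C * w ω := by
          rw [abs_mul, hw]; simp only [sq_abs]; gcongr
        refine (abs_mul_norm_exp_sub_one_sub_le τ (α := a * (X ω ^ 2 - 1)) (β := h * X ω) ?_ ?_
          hα (abs_nonneg _) hC hL).trans_eq ?_
        · exact (abs_add_le _ _).trans (by linarith [abs_nonneg (h * X ω)])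
        · exact (abs_add_le _ _).trans_eq (by rw [mul_assoc, abs_mul 2, abs_two])
        · rw [abs_mul]
          change _ = _ + 8 * C ^ 2 * |τ| * (_ + {v | L < v}.indicator (fun v => v ^ 2) (w ω))
          ring
    _ = 128 * τ ^ 2 * |h| ^ 3 * ∫ ω, |X ω| ^ 3 ∂P + 8 * C ^ 2 * |τ| *
        (2 * C * L * |τ| * ∫ ω, w ω ^ 2 ∂P + lindebergTail P X L) := by
        rw [integral_add hcube' ((hw2.fun_add hwL).const_mul _), integral_const_mul,
          integral_const_mul, integral_add hw2 hwL, integral_const_mul, htail]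
    _ ≤ _ := by
        gcongr
        · exact hX.integral_abs_cube_le
        · exact hX.integral_sq_sub_one_sq_le

lemma norm_integral_site_sub_siteCov_mul_exp_le {a C L : ℝ} (ha : |a| ≤ C) (hL : 0 ≤ L)
    (h τ : ℝ) :
    ‖∫ ω, ((a * (X ω ^ 2 - 1) + h * X ω : ℝ) - τ * (siteCov P X a h : ℝ) * Complex.I) *
      Complex.exp ((τ * (a * (X ω ^ 2 - 1) + 2 * h * X ω) : ℝ) * Complex.I) ∂P‖ ≤
      τ ^ 2 * m * (192 * |h| ^ 3 + 8 * C ^ 3 + 16 * C ^ 3 * L) +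
        8 * C ^ 2 * |τ| * lindebergTail P X L := by
  have hC : 0 ≤ C := (abs_nonneg a).trans ha
  have : 0 ≤ m := zero_le_one.trans hX.one_le
  have hstep := norm_integral_sub_mul_exp_le (hX.integrable_site a h) (hX.integrable_site a (2 * h))
    (hX.integrable_site_mul_increment a h) (hX.integral_site a h) τ
  rw [hX.integral_site_mul_increment] at hstep
  have hcross : |siteCov P X a h| * ∫ ω, |a * (X ω ^ 2 - 1) + 2 * h * X ω| ∂P ≤
      m * (8 * C ^ 3 + 64 * |h| ^ 3) :=
    calc _ ≤ m * ((C + |h|) * (C + 2 * |h|)) * (2 * (C + |h|)) :=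
          mul_le_mul (hX.abs_siteCov_le ha h) (hX.integral_abs_increment_le ha h)
            (integral_nonneg fun _ => abs_nonneg _) (by positivity)
      _ = m * (2 * ((C + |h|) ^ 2 * (C + 2 * |h|))) := by ring
      _ ≤ m * (8 * C ^ 3 + 64 * |h| ^ 3) := by
          gcongr
          have hcube := add_pow_le hC (mul_nonneg zero_le_two (abs_nonneg h)) 3
          have hle : (C + |h|) ^ 2 ≤ (C + 2 * |h|) ^ 2 := by gcongr; linarith [abs_nonneg h]
          have := mul_le_mul_of_nonneg_right hle (by positivity : 0 ≤ C + 2 * |h|)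
          norm_num [mul_pow] at hcube
          nlinarith
  have hrem := hX.integral_abs_site_mul_norm_exp_sub_le ha hL h τ
  refine (hstep.trans (add_le_add hrem ((mul_assoc _ _ _).trans_le
    (mul_le_mul_of_nonneg_left hcross (sq_nonneg τ))))).trans_eq ?_
  linear_combination (16 * C ^ 3 * L * m) * sq_abs τ

end

end IsStandardized

end Standardized

section Moments

variable {Ω : Type*} [MeasurableSpace Ω] {P : Measure Ω} {X Y : Ω → ℝ}

lemma integral_add_sq_of_indepFun (hXY : IndepFun X Y P) (hX : MemLp X 2 P) (hY : MemLp Y 2 P)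
    (hX0 : ∫ ω, X ω ∂P = 0) :
    ∫ ω, (X ω + Y ω) ^ 2 ∂P = ∫ ω, X ω ^ 2 ∂P + ∫ ω, Y ω ^ 2 ∂P := by
  have hcross := hXY.integral_fun_mul_eq_mul_integral hX.1 hY.1
  rw [hX0, zero_mul] at hcross
  have hmul : Integrable (fun ω => X ω * Y ω) P := hX.integrable_mul hY
  calc ∫ ω, (X ω + Y ω) ^ 2 ∂P = ∫ ω, (X ω ^ 2 + Y ω ^ 2 + 2 * (X ω * Y ω)) ∂P := by
        congr 1; funext ω; ring
    _ = ∫ ω, X ω ^ 2 ∂P + ∫ ω, Y ω ^ 2 ∂P := by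
        rw [integral_add (hX.integrable_sq.fun_add hY.integrable_sq) (hmul.const_mul 2),
          integral_add hX.integrable_sq hY.integrable_sq, integral_const_mul, hcross]
        ring

lemma memLp_two_mul (hX : MemLp X 4 P) (hY : MemLp Y 4 P) : MemLp (fun ω => X ω * Y ω) 2 P := by
  have : ENNReal.HolderTriple 4 4 2 := ⟨by
    rw [show (4 : ENNReal) = 2 * 2 by norm_num, ENNReal.mul_inv (by simp) (by simp), ← mul_add,
      ENNReal.inv_two_add_inv_two, mul_one]⟩
  exact hY.mul' hX

variable [IsProbabilityMeasure P]

lemma integral_add_pow_four_of_indepFun (hXY : IndepFun X Y P) (hX : MemLp X 4 P)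
    (hY : MemLp Y 4 P) (hX0 : ∫ ω, X ω ∂P = 0) (hY0 : ∫ ω, Y ω ∂P = 0) :
    ∫ ω, (X ω + Y ω) ^ 4 ∂P = ∫ ω, X ω ^ 4 ∂P +
      6 * ((∫ ω, X ω ^ 2 ∂P) * ∫ ω, Y ω ^ 2 ∂P) + ∫ ω, Y ω ^ 4 ∂P := by
  have hpow (i j : ℕ) : IndepFun (fun ω => X ω ^ i) (fun ω => Y ω ^ j) P :=
    hXY.comp (measurable_id.pow_const i) (measurable_id.pow_const j)
  have hint (i j : ℕ) (hi : i ≤ 4) (hj : j ≤ 4) (c : ℝ) :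
      Integrable (fun ω => c * (X ω ^ i * Y ω ^ j)) P :=
    ((hpow i j).integrable_mul (integrable_pow_of_memLp hX hi)
      (integrable_pow_of_memLp hY hj)).const_mul c
  have hmul (i j : ℕ) (c : ℝ) : ∫ ω, c * (X ω ^ i * Y ω ^ j) ∂P =
      c * ((∫ ω, X ω ^ i ∂P) * ∫ ω, Y ω ^ j ∂P) := by
    rw [integral_const_mul,
      (hpow i j).integral_fun_mul_eq_mul_integral (hX.1.pow i) (hY.1.pow j)]
  calc ∫ ω, (X ω + Y ω) ^ 4 ∂P
      = ∫ ω, (1 * (X ω ^ 4 * Y ω ^ 0) + 4 * (X ω ^ 3 * Y ω ^ 1) + 6 * (X ω ^ 2 * Y ω ^ 2) +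
          4 * (X ω ^ 1 * Y ω ^ 3) + 1 * (X ω ^ 0 * Y ω ^ 4)) ∂P := by
        congr 1; funext ω; ring
    _ = _ := by
        have h₄ := hint 4 0 (by norm_num) (by norm_num) 1
        have h₃ := h₄.fun_add (hint 3 1 (by norm_num) (by norm_num) 4)
        have h₂ := h₃.fun_add (hint 2 2 (by norm_num) (by norm_num) 6)
        have h₁ := h₂.fun_add (hint 1 3 (by norm_num) (by norm_num) 4)
        rw [integral_add h₁ (hint 0 4 (by norm_num) (by norm_num) 1),
          integral_add h₂ (hint 1 3 (by norm_num) (by norm_num) 4),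
          integral_add h₃ (hint 2 2 (by norm_num) (by norm_num) 6),
          integral_add h₄ (hint 3 1 (by norm_num) (by norm_num) 4), hmul, hmul, hmul, hmul, hmul]
        simp only [pow_one, pow_zero, hX0, hY0, integral_const, probReal_univ, smul_eq_mul]
        ring

lemma sq_integral_abs_le (hX : MemLp X 2 P) : (∫ ω, |X ω| ∂P) ^ 2 ≤ ∫ ω, X ω ^ 2 ∂P := by
  have h := variance_nonneg |X| P
  rw [variance_eq_sub hX.abs] at h
  simpa [sq_abs] using h

lemma memLp_siteCov (hY : MemLp Y 4 P) (X : Ω → ℝ) (a : ℝ) :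
    MemLp (fun ω => siteCov P X a (Y ω)) 2 P := by
  have h2 : MemLp (fun ω => Y ω ^ 2) 2 P := by
    simpa only [sq] using memLp_two_mul hY hY
  have hlin (c₀ c₁ : ℝ) : MemLp (fun ω => c₀ + c₁ * Y ω + 2 * Y ω ^ 2) 2 P :=
    ((memLp_const c₀).add ((hY.mono_exponent (by norm_num)).const_mul c₁)).add (h2.const_mul 2)
  convert hlin (a ^ 2 * (∫ ω, X ω ^ 4 ∂P - 1)) (3 * a * ∫ ω, X ω ^ 3 ∂P) using 2
  rw [siteCov]; ring

lemma integral_siteCov (hY : MemLp Y 2 P) (hY0 : ∫ ω, Y ω ∂P = 0) (X : Ω → ℝ) (a : ℝ) :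
    ∫ ω, siteCov P X a (Y ω) ∂P = a ^ 2 * (∫ ω, X ω ^ 4 ∂P - 1) + 2 * ∫ ω, Y ω ^ 2 ∂P := by
  have hlin (c₀ c₁ : ℝ) : ∫ ω, (c₀ + c₁ * Y ω + 2 * Y ω ^ 2) ∂P = c₀ + 2 * ∫ ω, Y ω ^ 2 ∂P := by
    have h1 := (hY.integrable (by norm_num)).const_mul c₁
    rw [integral_add ((integrable_const c₀).fun_add h1) (hY.integrable_sq.const_mul 2),
      integral_add (integrable_const c₀) h1, integral_const_mul, integral_const_mul, hY0]
    simp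
  rw [← hlin _ (3 * a * ∫ ω, X ω ^ 3 ∂P)]
  congr 1; funext ω; rw [siteCov]; ring

end Moments

section LinearForm

open scoped Matrix Matrix.Norms.L2Operator

variable {Ω ι : Type*} [MeasurableSpace Ω] {P : Measure Ω}
  {z : ι → Ω → ℝ} {m : ℝ}

lemma memLp_sum_const_mul (hz : ∀ i, IsStandardized (z i) P m) (s : Finset ι) (b : ι → ℝ) :
    MemLp (fun ω => ∑ i ∈ s, b i * z i ω) 4 P :=
  memLp_finsetSum s fun i _ => (hz i).memLp.const_mul (b i)

lemma indepFun_sum_const_mul (hz : ∀ i, IsStandardized (z i) P m) (hind : iIndepFun z P)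
    {s : Finset ι} {k : ι} (hk : k ∉ s) (b : ι → ℝ) :
    IndepFun (fun ω => ∑ i ∈ s, b i * z i ω) (fun ω => b k * z k ω) P := by
  have h := (hind.comp (fun i x => b i * x) fun i =>
    measurable_const_mul (b i)).indepFun_finsetSum_of_notMem
      (fun i => (hz i).measurable.const_mul (b i)) hk
  simpa only [Finset.sum_fn, Function.comp_def] using h

variable [IsProbabilityMeasure P]

lemma integral_sum_const_mul (hz : ∀ i, IsStandardized (z i) P m) (s : Finset ι) (b : ι → ℝ) :
    ∫ ω, ∑ i ∈ s, b i * z i ω ∂P = 0 := by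
  rw [integral_finsetSum _ fun i _ => (hz i).integrable.const_mul (b i)]
  simp [integral_const_mul, (hz _).mean]

lemma integral_sq_sum_const_mul (hz : ∀ i, IsStandardized (z i) P m) (hind : iIndepFun z P)
    (s : Finset ι) (b : ι → ℝ) : ∫ ω, (∑ i ∈ s, b i * z i ω) ^ 2 ∂P = ∑ i ∈ s, b i ^ 2 := by
  classical
  induction s using Finset.induction_on with
  | empty => simp
  | insert k s hk ih =>
    have h4 : (2 : ENNReal) ≤ 4 := by norm_num
    simp_rw [Finset.sum_insert hk, add_comm (b k * _)]
    rw [integral_add_sq_of_indepFun (indepFun_sum_const_mul hz hind hk b)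
        ((memLp_sum_const_mul hz s b).mono_exponent h4)
        (((hz k).memLp.const_mul (b k)).mono_exponent h4) (integral_sum_const_mul hz s b), ih]
    simp [mul_pow, integral_const_mul, (hz k).sq, add_comm]

lemma integral_pow_four_sum_const_mul_le (hz : ∀ i, IsStandardized (z i) P m)
    (hind : iIndepFun z P) (s : Finset ι) (b : ι → ℝ) :
    ∫ ω, (∑ i ∈ s, b i * z i ω) ^ 4 ∂P ≤ 3 * m * (∑ i ∈ s, b i ^ 2) ^ 2 := by
  classical
  induction s using Finset.induction_on with
  | empty => simp
  | insert k s hk ih =>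
    have hm := (hz k).one_le
    have hσ : 0 ≤ ∑ i ∈ s, b i ^ 2 := by positivity
    simp_rw [Finset.sum_insert hk, add_comm (b k * _)]
    rw [integral_add_pow_four_of_indepFun (indepFun_sum_const_mul hz hind hk b)
      (memLp_sum_const_mul hz s b) ((hz k).memLp.const_mul (b k)) (integral_sum_const_mul hz s b)
      (by rw [integral_const_mul, (hz k).mean, mul_zero]), integral_sq_sum_const_mul hz hind]
    simp only [mul_pow, integral_const_mul, (hz k).sq]
    nlinarith [mul_le_mul_of_nonneg_left (hz k).fourth (by positivity : 0 ≤ b k ^ 4),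
      mul_nonneg (sub_nonneg.2 hm) (mul_nonneg hσ (sq_nonneg (b k))),
      mul_nonneg (zero_le_one.trans hm) (by positivity : 0 ≤ b k ^ 4)]

lemma integral_abs_cube_sum_const_mul_le (hz : ∀ i, IsStandardized (z i) P m)
    (hind : iIndepFun z P) (s : Finset ι) {b : ι → ℝ} {K : ℝ} (hK : 0 < K) (hm : 1 ≤ m)
    (hb : ∑ i ∈ s, b i ^ 2 ≤ K ^ 2) :
    ∫ ω, |∑ i ∈ s, b i * z i ω| ^ 3 ∂P ≤ 2 * m * K ^ 3 := by
  have hL := memLp_sum_const_mul hz s b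
  have h2 : Integrable (fun ω => (∑ i ∈ s, b i * z i ω) ^ 2) P :=
    integrable_pow_of_memLp hL (by norm_num)
  have h4 : Integrable (fun ω => (∑ i ∈ s, b i * z i ω) ^ 4) P :=
    integrable_pow_of_memLp hL le_rfl
  have hle (x : ℝ) : |x| ^ 3 ≤ x ^ 4 / (2 * K) + K / 2 * x ^ 2 := by
    rw [← sq_abs x, ← (by decide : Even 4).pow_abs x]
    field_simp
    nlinarith [mul_nonneg (sq_nonneg |x|) (sq_nonneg (|x| - K))]
  calc ∫ ω, |∑ i ∈ s, b i * z i ω| ^ 3 ∂P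
      ≤ ∫ ω, ((∑ i ∈ s, b i * z i ω) ^ 4 / (2 * K) + K / 2 * (∑ i ∈ s, b i * z i ω) ^ 2) ∂P :=
        integral_mono_of_nonneg (.of_forall fun ω => by positivity)
          ((h4.div_const _).add (h2.const_mul _)) (.of_forall fun ω => hle _)
    _ = (∫ ω, (∑ i ∈ s, b i * z i ω) ^ 4 ∂P) / (2 * K) + K / 2 * ∑ i ∈ s, b i ^ 2 := by
        rw [integral_add (h4.div_const _) (h2.const_mul _), integral_div, integral_const_mul,
          integral_sq_sum_const_mul hz hind]
    _ ≤ 3 * m * (K ^ 2) ^ 2 / (2 * K) + K / 2 * K ^ 2 := by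
        gcongr
        exact (integral_pow_four_sum_const_mul_le hz hind s b).trans (by gcongr)
    _ ≤ 2 * m * K ^ 3 := by
        field_simp
        nlinarith [pow_pos hK 3]

end LinearForm

section QuadraticForm

open scoped Matrix Matrix.Norms.L2Operator

variable {Ω ι : Type*} [MeasurableSpace Ω] {P : Measure Ω} [Fintype ι]
  {z : ι → Ω → ℝ} {m : ℝ}

lemma measurable_mulVec_apply (A : Matrix ι ι ℝ) (k : ι) :
    Measurable fun x : ι → ℝ => (A *ᵥ x) k := by
  simp only [Matrix.mulVec, dotProduct]
  fun_prop

lemma measurable_centredQuadForm (A : Matrix ι ι ℝ) : Measurable (centredQuadForm A) := by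
  unfold centredQuadForm Matrix.mulVec dotProduct
  fun_prop

variable [DecidableEq ι] {A : Matrix ι ι ℝ}

/-- The contribution of the coordinate `k` to the centred quadratic form of `A` at `x`. -/
def siteTerm (A : Matrix ι ι ℝ) (k : ι) (x : ι → ℝ) : ℝ :=
  A k k * (x k ^ 2 - 1) + (offDiagPart A *ᵥ x) k * x k

lemma measurable_siteTerm (A : Matrix ι ι ℝ) (k : ι) : Measurable (siteTerm A k) := by
  have := measurable_mulVec_apply (offDiagPart A) k
  unfold siteTerm
  fun_prop

lemma siteTerm_update (A : Matrix ι ι ℝ) (k : ι) (x : ι → ℝ) (c : ℝ) :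
    siteTerm A k (Function.update x k c) =
      A k k * (c ^ 2 - 1) + (offDiagPart A *ᵥ x) k * c := by
  rw [siteTerm, offDiagPart_mulVec_update, Function.update_self]

variable [IsProbabilityMeasure P]

lemma memLp_siteTerm (hz : ∀ i, IsStandardized (z i) P m) (A : Matrix ι ι ℝ) (k : ι) :
    MemLp (fun ω => siteTerm A k fun i => z i ω) 2 P := by
  have hsq : MemLp (fun ω => z k ω ^ 2) 2 P := by
    simpa only [sq] using memLp_two_mul (hz k).memLp (hz k).memLp
  exact ((hsq.sub (memLp_const 1)).const_mul (A k k)).add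
    (memLp_two_mul (memLp_sum_const_mul hz _ _) (hz k).memLp)

omit [DecidableEq ι] in
lemma memLp_centredQuadForm (hz : ∀ i, IsStandardized (z i) P m) (A : Matrix ι ι ℝ) :
    MemLp (fun ω => centredQuadForm A fun i => z i ω) 2 P := by
  classical
  simp only [centredQuadForm_eq_sum]
  exact memLp_finsetSum _ fun k _ => memLp_siteTerm hz A k

lemma integral_siteTerm_mul_centredQuadForm (hz : ∀ i, IsStandardized (z i) P m)
    (hind : iIndepFun z P) (hA : A.IsSymm) (k : ι) :
    ∫ ω, siteTerm A k (fun i => z i ω) * centredQuadForm A (fun i => z i ω) ∂P =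
      ∫ ω, siteCov P (z k) (A k k) ((offDiagPart A *ᵥ fun i => z i ω) k) ∂P := by
  rw [integral_eq_integral_integral_update hind (fun i => (hz i).measurable)
    (F := fun x => siteTerm A k x * centredQuadForm A x)
    ((measurable_siteTerm A k).mul (measurable_centredQuadForm A)).stronglyMeasurable
    ((memLp_siteTerm hz A k).integrable_mul (memLp_centredQuadForm hz A)) k]
  congr 1
  funext ω
  set h := (offDiagPart A *ᵥ fun i => z i ω) k
  set c := centredQuadForm A (Function.update (fun i => z i ω) k 0) + A k k
  have hU := ((hz k).integrable_site (A k k) h).mul_const c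
  calc _ = ∫ ω', ((A k k * (z k ω' ^ 2 - 1) + h * z k ω') * c +
        (A k k * (z k ω' ^ 2 - 1) + h * z k ω') *
          (A k k * (z k ω' ^ 2 - 1) + 2 * h * z k ω')) ∂P := by
        congr 1; funext ω'; rw [siteTerm_update, centredQuadForm_update hA, mul_add]
    _ = siteCov P (z k) (A k k) h := by
        rw [integral_add hU ((hz k).integrable_site_mul_increment _ _), integral_mul_const,
          (hz k).integral_site, zero_mul, zero_add, (hz k).integral_site_mul_increment]

lemma integral_siteCov_offDiagPart_mulVec (hz : ∀ i, IsStandardized (z i) P m)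
    (hind : iIndepFun z P) (A : Matrix ι ι ℝ) (k : ι) :
    ∫ ω, siteCov P (z k) (A k k) ((offDiagPart A *ᵥ fun i => z i ω) k) ∂P =
      A k k ^ 2 * (∫ ω, z k ω ^ 4 ∂P - 1) + 2 * ∑ j, offDiagPart A k j ^ 2 := by
  rw [← integral_sq_sum_const_mul hz hind Finset.univ (offDiagPart A k)]
  exact integral_siteCov ((memLp_sum_const_mul hz _ _).mono_exponent (by norm_num))
    (integral_sum_const_mul hz _ _) _ _

omit [DecidableEq ι] in
lemma integral_sq_centredQuadForm (hz : ∀ i, IsStandardized (z i) P m) (hind : iIndepFun z P)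
    (hA : A.IsSymm) :
    ∫ ω, (centredQuadForm A fun i => z i ω) ^ 2 ∂P =
      quadFormVariance (fun i => kappa4 P (z i)) A := by
  classical
  have hsum (x : ι → ℝ) :
      centredQuadForm A x ^ 2 = ∑ k, siteTerm A k x * centredQuadForm A x := by
    rw [sq, ← Finset.sum_mul, centredQuadForm_eq_sum]; rfl
  simp only [hsum]
  have hint (k : ι) : Integrable (fun ω => siteTerm A k (fun i => z i ω) *
      centredQuadForm A fun i => z i ω) P :=
    (memLp_siteTerm hz A k).integrable_mul (memLp_centredQuadForm hz A)
  rw [integral_finsetSum _ fun k _ => hint k]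
  simp only [integral_siteTerm_mul_centredQuadForm hz hind hA,
    integral_siteCov_offDiagPart_mulVec hz hind,
    quadFormVariance, trace_transpose_mul_self_eq_diag_add_offDiagPart, kappa4, mul_add,
    Finset.mul_sum, ← Finset.sum_add_distrib, (by decide : Even 4).pow_abs]
  exact Finset.sum_congr rfl fun k _ => by ring

omit [DecidableEq ι] in
lemma quadFormVariance_kappa4_nonneg (hz : ∀ i, IsStandardized (z i) P m)
    (hind : iIndepFun z P) (hA : A.IsSymm) :
    0 ≤ quadFormVariance (fun i => kappa4 P (z i)) A := by
  classical
  rw [← integral_sq_centredQuadForm hz hind hA]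
  positivity

lemma integral_sq_centredQuadForm_le (hz : ∀ i, IsStandardized (z i) P m)
    (hind : iIndepFun z P) (hm : 1 ≤ m) (hA : A.IsSymm) :
    ∫ ω, (centredQuadForm A fun i => z i ω) ^ 2 ∂P ≤
      2 * m * (Fintype.card ι * ‖A‖ ^ 2) := by
  have hκ (i : ι) : kappa4 P (z i) ≤ m - 3 := by
    have := (hz i).fourth
    simp only [kappa4, (by decide : Even 4).pow_abs]
    linarith
  rw [integral_sq_centredQuadForm hz hind hA]
  exact (quadFormVariance_le hm hκ A).trans (by gcongr; exact trace_transpose_mul_self_le A)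

lemma sum_siteCov_sub_quadFormVariance (P : Measure Ω) (z : ι → Ω → ℝ) (A : Matrix ι ι ℝ)
    (x : ι → ℝ) :
    ∑ k, siteCov P (z k) (A k k) ((offDiagPart A *ᵥ x) k) -
        quadFormVariance (fun i => kappa4 P (z i)) A =
      3 * ∑ j, ((offDiagPart A)ᵀ *ᵥ fun k => A k k * ∫ ω, z k ω ^ 3 ∂P) j * x j +
        2 * centredQuadForm ((offDiagPart A)ᵀ * offDiagPart A) x := by
  set O := offDiagPart A with hO
  have hlin : ∑ j, (Oᵀ *ᵥ fun k => A k k * ∫ ω, z k ω ^ 3 ∂P) j * x j =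
      ∑ k, A k k * (∫ ω, z k ω ^ 3 ∂P) * (O *ᵥ x) k := by
    change (Oᵀ *ᵥ _) ⬝ᵥ x = _
    rw [Matrix.mulVec_transpose, ← Matrix.dotProduct_mulVec]; rfl
  have hquad : centredQuadForm (Oᵀ * O) x = ∑ k, (O *ᵥ x) k ^ 2 - ∑ k, ∑ j, O k j ^ 2 := by
    rw [centredQuadForm, trace_transpose_mul_self_eq_sum, ← Matrix.mulVec_mulVec,
      Matrix.dotProduct_mulVec, Matrix.vecMul_transpose]
    simp only [dotProduct, sq]
  rw [hlin, hquad, quadFormVariance, trace_transpose_mul_self_eq_diag_add_offDiagPart]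
  simp only [siteCov, kappa4, (by decide : Even 4).pow_abs, Finset.sum_add_distrib,
    Finset.mul_sum, mul_sub, mul_add, ← hO, Finset.sum_sub_distrib]
  have h3 (k : ι) : 3 * A k k * (O *ᵥ x) k * ∫ ω, z k ω ^ 3 ∂P =
      3 * (A k k * (∫ ω, z k ω ^ 3 ∂P) * (O *ᵥ x) k) := by ring
  have h4 (k : ι) : A k k ^ 2 * 3 = A k k ^ 2 * 1 + 2 * A k k ^ 2 := by ring
  simp only [h3, h4, Finset.sum_add_distrib]
  ring

lemma integral_sq_sum_siteCov_sub_le (hz : ∀ i, IsStandardized (z i) P m)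
    (hind : iIndepFun z P) (hm : 1 ≤ m) (hA : A.IsSymm) {C : ℝ} (hC : ‖A‖ ≤ C) :
    ∫ ω, (∑ k, siteCov P (z k) (A k k) ((offDiagPart A *ᵥ fun i => z i ω) k) -
        quadFormVariance (fun i => kappa4 P (z i)) A) ^ 2 ∂P ≤
      328 * m ^ 2 * C ^ 4 * Fintype.card ι := by
  simp only [sum_siteCov_sub_quadFormVariance]
  set ℓ : Ω → ℝ := fun ω =>
    ∑ j, ((offDiagPart A)ᵀ *ᵥ fun k => A k k * ∫ ω, z k ω ^ 3 ∂P) j * z j ω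
  set q : Ω → ℝ := fun ω => centredQuadForm ((offDiagPart A)ᵀ * offDiagPart A) fun i => z i ω
  have hℓ : ∫ ω, ℓ ω ^ 2 ∂P ≤ Fintype.card ι * (2 * C * (C * m)) ^ 2 := by
    rw [integral_sq_sum_const_mul hz hind]
    refine sum_sq_transpose_offDiagPart_mulVec_le hA hC fun k => ?_
    rw [abs_mul]
    exact mul_le_mul ((abs_apply_le_norm A k k).trans hC) (hz k).abs_integral_cube_le
      (abs_nonneg _) ((norm_nonneg A).trans hC)
  have hq : ∫ ω, q ω ^ 2 ∂P ≤ 2 * m * (Fintype.card ι * ((2 * C) ^ 2) ^ 2) := by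
    refine (integral_sq_centredQuadForm_le hz hind hm (Matrix.isSymm_transpose_mul_self _)).trans ?_
    gcongr
    exact norm_transpose_mul_self_offDiagPart_le hA hC
  have hℓi : Integrable (fun ω => ℓ ω ^ 2) P :=
    integrable_pow_of_memLp (memLp_sum_const_mul hz _ _) (by norm_num)
  have hqi : Integrable (fun ω => q ω ^ 2) P := (memLp_centredQuadForm hz _).integrable_sq
  calc ∫ ω, (3 * ℓ ω + 2 * q ω) ^ 2 ∂P ≤ ∫ ω, (18 * ℓ ω ^ 2 + 8 * q ω ^ 2) ∂P :=
        integral_mono_of_nonneg (.of_forall fun ω => sq_nonneg _)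
          ((hℓi.const_mul 18).add (hqi.const_mul 8))
          (.of_forall fun ω => by nlinarith [sq_nonneg (3 * ℓ ω - 2 * q ω)])
    _ = 18 * ∫ ω, ℓ ω ^ 2 ∂P + 8 * ∫ ω, q ω ^ 2 ∂P := by
        rw [integral_add (hℓi.const_mul 18) (hqi.const_mul 8), integral_const_mul,
          integral_const_mul]
    _ ≤ _ := by
        have : m * (C ^ 4 * Fintype.card ι) ≤ m ^ 2 * (C ^ 4 * Fintype.card ι) := by
          gcongr; nlinarith
        nlinarith

lemma integral_abs_sum_siteCov_sub_le (hz : ∀ i, IsStandardized (z i) P m)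
    (hind : iIndepFun z P) (hm : 1 ≤ m) (hA : A.IsSymm) {C : ℝ} (hC : ‖A‖ ≤ C) :
    ∫ ω, |∑ k, siteCov P (z k) (A k k) ((offDiagPart A *ᵥ fun i => z i ω) k) -
        quadFormVariance (fun i => kappa4 P (z i)) A| ∂P ≤
      19 * m * C ^ 2 * √(Fintype.card ι) := by
  have hL : MemLp (fun ω => ∑ k, siteCov P (z k) (A k k) ((offDiagPart A *ᵥ fun i => z i ω) k) -
      quadFormVariance (fun i => kappa4 P (z i)) A) 2 P :=
    (memLp_finsetSum _ fun k _ => memLp_siteCov (memLp_sum_const_mul hz _ _) _ _).sub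
      (memLp_const _)
  refine abs_le_of_sq_le_sq' ?_ (by positivity) |>.2
  refine (sq_integral_abs_le hL).trans
    ((integral_sq_sum_siteCov_sub_le hz hind hm hA hC).trans ?_)
  rw [mul_pow, Real.sq_sqrt (Nat.cast_nonneg _), mul_pow, mul_pow, ← pow_mul]
  gcongr
  norm_num

end QuadraticForm

section CharFun

open scoped Matrix Matrix.Norms.L2Operator

variable {Ω ι : Type*} [MeasurableSpace Ω] {P : Measure Ω}

lemma integrable_mul_exp_ofReal_mul_I {f : Ω → ℂ} {g : Ω → ℝ} (hf : Integrable f P)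
    (hg : AEStronglyMeasurable g P) :
    Integrable (fun ω => f ω * Complex.exp (g ω * Complex.I)) P :=
  hf.mul_bdd (c := 1) (Complex.continuous_exp.comp_aestronglyMeasurable
    ((Complex.continuous_ofReal.comp_aestronglyMeasurable hg).mul_const _))
    (.of_forall fun _ => (Complex.norm_exp_ofReal_mul_I _).le)

lemma hasDerivAt_integral_exp_mul_I [IsProbabilityMeasure P] {X : Ω → ℝ} (hX : Integrable X P)
    (τ : ℝ) :
    HasDerivAt (fun τ : ℝ => ∫ ω, Complex.exp ((τ * X ω : ℝ) * Complex.I) ∂P)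
      (Complex.I * ∫ ω, X ω * Complex.exp ((τ * X ω : ℝ) * Complex.I) ∂P) τ := by
  have hint {f : Ω → ℂ} (hf : Integrable f P) (τ : ℝ) :=
    integrable_mul_exp_ofReal_mul_I hf (hX.aestronglyMeasurable.const_mul τ)
  have hexp (τ : ℝ) : Integrable (fun ω => Complex.exp ((τ * X ω : ℝ) * Complex.I)) P := by
    simpa only [one_mul] using hint (integrable_const 1) τ
  rw [← integral_const_mul]
  refine (hasDerivAt_integral_of_dominated_loc_of_deriv_le
    (F := fun τ ω => Complex.exp ((τ * X ω : ℝ) * Complex.I))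
    (F' := fun τ ω => Complex.I * (X ω * Complex.exp ((τ * X ω : ℝ) * Complex.I)))
    (bound := fun ω => ‖X ω‖) univ_mem
    (.of_forall fun τ => (hexp τ).aestronglyMeasurable) (hexp τ)
    ((hint hX.ofReal τ).const_mul _).aestronglyMeasurable (.of_forall fun ω σ _ => ?_)
    hX.norm (.of_forall fun ω σ _ => ?_)).2
  · rw [norm_mul, norm_mul, Complex.norm_I, Complex.norm_exp_ofReal_mul_I, Complex.norm_real,
      one_mul, mul_one]
  · have hlin : HasDerivAt (fun σ : ℝ => ((σ * X ω : ℝ) : ℂ) * Complex.I)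
        ((X ω : ℝ) * Complex.I) σ :=
      (hasDerivAt_mul_const (X ω)).ofReal_comp.mul_const Complex.I
    exact hlin.cexp.congr_deriv (by ring)

variable [Fintype ι] [DecidableEq ι] {z : ι → Ω → ℝ} {m : ℝ} {A : Matrix ι ι ℝ}

/-- The integrand measuring how far the coordinate `k` is from satisfying Stein's identity
`E[Q e^{iτQ}] = iτ (Var Q) E[e^{iτQ}]` for the centred quadratic form `Q` of `A`. -/
noncomputable def steinDefect (P : Measure Ω) (z : ι → Ω → ℝ) (A : Matrix ι ι ℝ) (τ : ℝ) (k : ι)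
    (x : ι → ℝ) : ℂ :=
  (siteTerm A k x -
      τ * (siteCov P (z k) (A k k) ((offDiagPart A *ᵥ x) k) : ℝ) * Complex.I) *
    Complex.exp ((τ * centredQuadForm A x : ℝ) * Complex.I)

lemma measurable_steinDefect (P : Measure Ω) (z : ι → Ω → ℝ) (A : Matrix ι ι ℝ) (τ : ℝ) (k : ι) :
    Measurable (steinDefect P z A τ k) := by
  have h₁ := measurable_siteTerm A k
  have h₂ := measurable_centredQuadForm A
  have h₃ := measurable_mulVec_apply (offDiagPart A) k
  unfold steinDefect siteCov
  fun_prop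

lemma steinDefect_update (P : Measure Ω) (z : ι → Ω → ℝ) (hA : A.IsSymm) (τ : ℝ) (k : ι)
    (x : ι → ℝ) (c : ℝ) :
    steinDefect P z A τ k (Function.update x k c) =
      ((A k k * (c ^ 2 - 1) + (offDiagPart A *ᵥ x) k * c : ℝ) -
          τ * (siteCov P (z k) (A k k) ((offDiagPart A *ᵥ x) k) : ℝ) * Complex.I) *
        Complex.exp ((τ * (A k k * (c ^ 2 - 1) + 2 * (offDiagPart A *ᵥ x) k * c) : ℝ) *
          Complex.I) *
      Complex.exp ((τ * (centredQuadForm A (Function.update x k 0) + A k k) : ℝ) * Complex.I) := by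
  rw [steinDefect, siteTerm_update, offDiagPart_mulVec_update, centredQuadForm_update hA,
    mul_add τ (_ + _), Complex.ofReal_add (τ * _), add_mul (Complex.ofReal _), Complex.exp_add]
  ring

lemma sum_steinDefect (P : Measure Ω) (z : ι → Ω → ℝ) (A : Matrix ι ι ℝ) (τ : ℝ) (x : ι → ℝ) :
    ∑ k, steinDefect P z A τ k x =
      (centredQuadForm A x -
          τ * (∑ k, siteCov P (z k) (A k k) ((offDiagPart A *ᵥ x) k) : ℝ) * Complex.I) *
        Complex.exp ((τ * centredQuadForm A x : ℝ) * Complex.I) := by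
  simp only [steinDefect, ← Finset.sum_mul, Finset.sum_sub_distrib, ← Finset.mul_sum,
    ← Complex.ofReal_sum]
  rw [centredQuadForm_eq_sum]
  rfl

variable [IsProbabilityMeasure P]

lemma integrable_steinDefect (hz : ∀ i, IsStandardized (z i) P m) (A : Matrix ι ι ℝ) (τ : ℝ)
    (k : ι) : Integrable (fun ω => steinDefect P z A τ k fun i => z i ω) P :=
  integrable_mul_exp_ofReal_mul_I
    (((memLp_siteTerm hz A k).integrable one_le_two).ofReal.sub
      ((((memLp_siteCov (memLp_sum_const_mul hz _ _) _ _).integrable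
        one_le_two).ofReal.const_mul _).mul_const _))
    ((memLp_centredQuadForm hz A).aestronglyMeasurable.const_mul τ)

lemma norm_integral_steinDefect_le (hz : ∀ i, IsStandardized (z i) P m)
    (hind : iIndepFun z P) (hA : A.IsSymm) {C L : ℝ} (hC0 : 0 < C) (hC : ‖A‖ ≤ C)
    (hL : 0 ≤ L) (τ : ℝ) (k : ι) :
    ‖∫ ω, steinDefect P z A τ k (fun i => z i ω) ∂P‖ ≤
      τ ^ 2 * (3080 * m ^ 2 * C ^ 3 + 16 * m * C ^ 3 * L) +
        8 * C ^ 2 * |τ| * lindebergTail P (z k) L := by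
  have hm := (hz k).one_le
  set h : Ω → ℝ := fun ω => (offDiagPart A *ᵥ fun i => z i ω) k
  have hcube : ∫ ω, |h ω| ^ 3 ∂P ≤ 2 * m * (2 * C) ^ 3 :=
    integral_abs_cube_sum_const_mul_le hz hind _ (by positivity) hm
      ((sum_sq_offDiagPart_row_le hA k).trans (by gcongr))
  have hcubei : Integrable (fun ω => |h ω| ^ 3) P := by
    have hh : MemLp h 4 P := memLp_sum_const_mul hz _ _
    simpa only [abs_pow] using (integrable_pow_of_memLp hh (by norm_num)).abs
  have hone (ω : Ω) :
      ‖∫ ω', steinDefect P z A τ k (Function.update (fun i => z i ω) k (z k ω')) ∂P‖ ≤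
        192 * (τ ^ 2 * m) * |h ω| ^ 3 + (τ ^ 2 * m * (8 * C ^ 3 + 16 * C ^ 3 * L) +
          8 * C ^ 2 * |τ| * lindebergTail P (z k) L) := by
    simp only [steinDefect_update P z hA]
    rw [integral_mul_const, norm_mul, Complex.norm_exp_ofReal_mul_I, mul_one]
    refine ((hz k).norm_integral_site_sub_siteCov_mul_exp_le
      ((abs_apply_le_norm A k k).trans hC) hL (h ω) τ).trans_eq ?_
    ring
  rw [integral_eq_integral_integral_update hind (fun i => (hz i).measurable)
    (measurable_steinDefect P z A τ k).stronglyMeasurable (integrable_steinDefect hz A τ k) k]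
  refine (norm_integral_le_integral_norm _).trans <| (integral_mono_of_nonneg
    (.of_forall fun ω => norm_nonneg _) ((hcubei.const_mul _).add (integrable_const _))
    (.of_forall hone)).trans ?_
  simp only [Pi.add_apply]
  rw [integral_add (hcubei.const_mul _) (integrable_const _), integral_const_mul, integral_const,
    probReal_univ, one_smul]
  have hmsq : τ ^ 2 * (C ^ 3 * m) ≤ τ ^ 2 * (C ^ 3 * m ^ 2) := by gcongr; nlinarith
  have := mul_le_mul_of_nonneg_left hcube (by positivity : 0 ≤ 192 * (τ ^ 2 * m))
  nlinarith

lemma norm_integral_mul_exp_sub_le (hz : ∀ i, IsStandardized (z i) P m)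
    (hind : iIndepFun z P) (hm : 1 ≤ m) (hA : A.IsSymm) {C L : ℝ} (hC0 : 0 < C) (hC : ‖A‖ ≤ C)
    (hL : 0 ≤ L) (τ : ℝ) :
    ‖∫ ω, (centredQuadForm A (fun i => z i ω) -
          τ * quadFormVariance (fun i => kappa4 P (z i)) A * Complex.I) *
        Complex.exp ((τ * centredQuadForm A fun i => z i ω : ℝ) * Complex.I) ∂P‖ ≤
      Fintype.card ι * τ ^ 2 * (3080 * m ^ 2 * C ^ 3 + 16 * m * C ^ 3 * L) +
        |τ| * (8 * C ^ 2 * ∑ k, lindebergTail P (z k) L +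
          19 * m * C ^ 2 * √(Fintype.card ι)) := by
  set S : Ω → ℝ := fun ω => ∑ k, siteCov P (z k) (A k k) ((offDiagPart A *ᵥ fun i => z i ω) k) -
    quadFormVariance (fun i => kappa4 P (z i)) A with hS
  set e : Ω → ℂ := fun ω =>
    Complex.exp ((τ * centredQuadForm A fun i => z i ω : ℝ) * Complex.I) with he
  have hSi : Integrable S P := .sub (integrable_finsetSum _ fun k _ =>
    (memLp_siteCov (memLp_sum_const_mul hz _ _) _ _).integrable one_le_two) (integrable_const _)
  have hSe : Integrable (fun ω => S ω * e ω) P := integrable_mul_exp_ofReal_mul_I hSi.ofReal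
    ((memLp_centredQuadForm hz A).aestronglyMeasurable.const_mul τ)
  have hsplit (ω : Ω) : (centredQuadForm A (fun i => z i ω) -
      τ * quadFormVariance (fun i => kappa4 P (z i)) A * Complex.I) *
      Complex.exp ((τ * centredQuadForm A fun i => z i ω : ℝ) * Complex.I) =
        ∑ k, steinDefect P z A τ k (fun i => z i ω) + τ * Complex.I * (S ω * e ω) := by
    simp only [sum_steinDefect, hS, he]
    push_cast
    ring
  have hSle : ‖∫ ω, S ω * e ω ∂P‖ ≤ 19 * m * C ^ 2 * √(Fintype.card ι) := by
    refine (norm_integral_le_integral_norm _).trans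
      (le_trans (le_of_eq ?_) (integral_abs_sum_siteCov_sub_le hz hind hm hA hC))
    simp only [norm_mul, he, Complex.norm_exp_ofReal_mul_I, mul_one, Complex.norm_real,
      Real.norm_eq_abs, hS]
  have hsum := norm_sum_le_of_le Finset.univ fun k _ =>
    norm_integral_steinDefect_le hz hind hA hC0 hC hL τ k
  simp only [Finset.sum_add_distrib, ← Finset.mul_sum, Finset.sum_const, nsmul_eq_mul,
    Finset.card_univ] at hsum
  simp only [hsplit]
  rw [integral_add (integrable_finsetSum _ fun k _ => integrable_steinDefect hz A τ k)
    (hSe.const_mul _), integral_finsetSum _ fun k _ => integrable_steinDefect hz A τ k,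
    integral_const_mul]
  refine (norm_add_le_of_le hsum ((norm_mul_le _ _).trans
    (mul_le_mul_of_nonneg_left hSle (norm_nonneg _)))).trans_eq ?_
  rw [norm_mul, Complex.norm_I, mul_one, Complex.norm_real, Real.norm_eq_abs]
  ring

theorem norm_integral_exp_centredQuadForm_sub_le (hz : ∀ i, IsStandardized (z i) P m)
    (hind : iIndepFun z P) (hm : 1 ≤ m) (hA : A.IsSymm) {C L t : ℝ} (hC0 : 0 < C) (hC : ‖A‖ ≤ C)
    (hL : 0 ≤ L) (ht : 0 ≤ t) :
    ‖∫ ω, Complex.exp ((t * centredQuadForm A fun i => z i ω : ℝ) * Complex.I) ∂P -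
        Real.exp (-(t ^ 2 * quadFormVariance (fun i => kappa4 P (z i)) A) / 2)‖ ≤
      (Fintype.card ι * t ^ 2 * (3080 * m ^ 2 * C ^ 3 + 16 * m * C ^ 3 * L) +
        t * (8 * C ^ 2 * ∑ k, lindebergTail P (z k) L +
          19 * m * C ^ 2 * √(Fintype.card ι))) * t := by
  have hQ : Integrable (fun ω => centredQuadForm A fun i => z i ω) P :=
    (memLp_centredQuadForm hz A).integrable one_le_two
  refine norm_sub_exp_neg_le_of_norm_deriv_add_le (quadFormVariance_kappa4_nonneg hz hind hA) ht
    (hasDerivAt_integral_exp_mul_I hQ) (by simp) fun τ hτ => ?_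
  have hexp {f : Ω → ℂ} (hf : Integrable f P) : Integrable (fun ω =>
      f ω * Complex.exp ((τ * centredQuadForm A fun i => z i ω : ℝ) * Complex.I)) P :=
    integrable_mul_exp_ofReal_mul_I hf (hQ.aestronglyMeasurable.const_mul τ)
  have hQexp : Integrable (fun ω => (centredQuadForm A (fun i => z i ω) : ℂ) *
      Complex.exp ((τ * centredQuadForm A fun i => z i ω : ℝ) * Complex.I)) P := hexp hQ.ofReal
  have hφi := by simpa only [one_mul] using hexp (integrable_const 1)
  have hstein := norm_integral_mul_exp_sub_le hz hind hm hA hC0 hC hL τ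
  simp only [sub_mul] at hstein
  rw [integral_sub hQexp (hφi.const_mul _), integral_const_mul] at hstein
  have htail : 0 ≤ ∑ k, lindebergTail P (z k) L :=
    Finset.sum_nonneg fun k _ => integral_nonneg fun ω => by positivity
  refine le_trans (le_of_eq ?_) (hstein.trans ?_)
  · rw [← one_mul ‖_ - _‖, ← Complex.norm_I, ← norm_mul, mul_sub]
    congr 1
    linear_combination τ * quadFormVariance (fun i => kappa4 P (z i)) A *
      (∫ ω, Complex.exp ((τ * centredQuadForm A fun i => z i ω : ℝ) * Complex.I) ∂P) *
      Complex.I_sq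
  · obtain ⟨hτ0, hτt⟩ := hτ
    rw [abs_of_nonneg hτ0]
    gcongr

end CharFun

section InProbability

variable {Ω : ℕ → Type*} [∀ N, MeasurableSpace (Ω N)] {P : ∀ N, Measure (Ω N)}
  {X Y : ∀ N, Ω N → ℝ} {c d : ℝ}

namespace TendstoInProbConst

lemma congr (hX : TendstoInProbConst P X c) (h : ∀ N, ∀ᵐ ω ∂(P N), X N ω = Y N ω) :
    TendstoInProbConst P Y c := by
  intro ε hε
  refine (hX ε hε).congr fun N => measure_congr ?_
  filter_upwards [h N] with ω hω
  exact congrArg (fun x => ε ≤ |x - c|) hω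

lemma add (hX : TendstoInProbConst P X c) (hY : TendstoInProbConst P Y d) :
    TendstoInProbConst P (fun N ω => X N ω + Y N ω) (c + d) := by
  intro ε hε
  have h := (hX (ε / 2) (half_pos hε)).add (hY (ε / 2) (half_pos hε))
  rw [add_zero] at h
  refine tendsto_of_tendsto_of_tendsto_of_le_of_le tendsto_const_nhds h
    (fun _ => zero_le) fun N => (measure_mono fun ω hω => ?_).trans (measure_union_le _ _)
  by_contra hcon
  simp only [Set.mem_union, Set.mem_ofPred_eq, not_or, not_le] at hcon hω
  have := abs_add_le (X N ω - c) (Y N ω - d)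
  rw [sub_add_sub_comm] at this
  linarith

lemma const_mul (hX : TendstoInProbConst P X c) (k : ℝ) :
    TendstoInProbConst P (fun N ω => k * X N ω) (k * c) := by
  intro ε hε
  refine tendsto_of_tendsto_of_tendsto_of_le_of_le tendsto_const_nhds
    (hX (ε / (|k| + 1)) (by positivity)) (fun _ => zero_le) fun N => measure_mono fun ω hω => ?_
  simp only [Set.mem_ofPred_eq, ← mul_sub, abs_mul] at hω ⊢
  rw [div_le_iff₀ (by positivity)]
  nlinarith [abs_nonneg (X N ω - c)]

lemma sum {κ : Type*} (s : Finset κ) {X : κ → ∀ N, Ω N → ℝ} {c : κ → ℝ}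
    (h : ∀ i ∈ s, TendstoInProbConst P (X i) (c i)) :
    TendstoInProbConst P (fun N ω => ∑ i ∈ s, X i N ω) (∑ i ∈ s, c i) := by
  classical
  induction s using Finset.induction_on with
  | empty => intro ε hε; simp [not_le.2 hε]
  | insert k s hk ih =>
    simp only [Finset.sum_insert hk]
    exact (h k (s.mem_insert_self k)).add (ih fun i hi => h i (Finset.mem_insert_of_mem hi))

variable [∀ N, IsProbabilityMeasure (P N)]

lemma unique (hX : TendstoInProbConst P X c) (hY : TendstoInProbConst P X d) : c = d := by
  by_contra hcd
  have h := (hX.const_mul (-1)).add hY |c - d| (abs_pos.2 (sub_ne_zero.2 hcd))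
  have hcancel (N : ℕ) (ω : Ω N) : -1 * X N ω + X N ω - (-1 * c + d) = c - d := by ring
  simp only [hcancel, le_refl, Set.ofPred_true, measure_univ] at h
  exact one_ne_zero (tendsto_nhds_unique tendsto_const_nhds h)

lemma nonneg (hX : TendstoInProbConst P X c) (h : ∀ N, ∀ᵐ ω ∂(P N), 0 ≤ X N ω) : 0 ≤ c := by
  by_contra! hc
  have hfull (N : ℕ) : P N {ω | -c ≤ |X N ω - c|} = 1 := by
    rw [measure_congr (eventuallyEq_univ.2 ?_), measure_univ]
    filter_upwards [h N] with ω hω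
    exact le_abs.2 (.inl (by linarith))
  have hzero := hX (-c) (by linarith)
  simp only [hfull] at hzero
  exact one_ne_zero (tendsto_nhds_unique tendsto_const_nhds hzero)

lemma tendsto_integral_comp (hX : TendstoInProbConst P X c) (hXm : ∀ N, Measurable (X N))
    {f : ℝ → ℝ} (hf : Continuous f) {M : ℝ} (hM : ∀ x, |f x| ≤ M) :
    Tendsto (fun N => ∫ ω, f (X N ω) ∂(P N)) atTop (𝓝 (f c)) := by
  refine Metric.tendsto_nhds.2 fun ε hε => ?_
  obtain ⟨δ, hδ, hfδ⟩ := Metric.continuous_iff.1 hf c (ε / 2) (half_pos hε)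
  set S : ∀ N, Set (Ω N) := fun N => {ω | δ ≤ |X N ω - c|}
  have hSm (N : ℕ) : MeasurableSet (S N) :=
    measurableSet_le measurable_const ((hXm N).sub_const c).abs
  have hfi (N : ℕ) : Integrable (fun ω => f (X N ω)) (P N) :=
    .of_bound (hf.measurable.comp (hXm N)).aestronglyMeasurable M (.of_forall fun ω => hM _)
  have hpt (N : ℕ) (ω : Ω N) :
      ‖f (X N ω) - f c‖ ≤ ε / 2 + (S N).indicator (fun _ => 2 * M) ω := by
    by_cases hω : ω ∈ S N
    · rw [Set.indicator_of_mem hω]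
      linarith [norm_sub_le (f (X N ω)) (f c), hM (X N ω), hM c, Real.norm_eq_abs (f c),
        Real.norm_eq_abs (f (X N ω))]
    · rw [Set.indicator_of_notMem hω, add_zero]
      exact (hfδ _ (not_le.1 hω)).le
  have hle (N : ℕ) : dist (∫ ω, f (X N ω) ∂(P N)) (f c) ≤ ε / 2 + (P N).real (S N) * (2 * M) := by
    have hind := (integrable_const (2 * M)).indicator (μ := P N) (hSm N)
    have h := norm_integral_le_of_norm_le ((integrable_const _).add hind) (.of_forall (hpt N))
    simpa [integral_sub (hfi N) (integrable_const _), integral_add (integrable_const _) hind,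
      integral_indicator_const _ (hSm N), dist_eq_norm] using h
  have hlim : Tendsto (fun N => ε / 2 + (P N).real (S N) * (2 * M)) atTop (𝓝 (ε / 2)) := by
    have := (ENNReal.tendsto_toReal_zero_iff fun N => measure_ne_top _ _).2 (hX δ hδ)
    have := (this.mul_const (2 * M)).const_add (ε / 2)
    rwa [zero_mul, add_zero] at this
  filter_upwards [hlim.eventually_lt_const (half_lt_self hε)] with N hN
  exact (hle N).trans_lt hN

end TendstoInProbConst

end InProbability

section RandomMatrix

open scoped Matrix Matrix.Norms.L2Operator

variable {Ω ι : Type*} [MeasurableSpace Ω] {P : Measure Ω} [Fintype ι]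
  {A : Ω → Matrix ι ι ℝ}

lemma measurable_uncurry_centredQuadForm :
    Measurable fun p : (ι → ℝ) × (ι → ι → ℝ) => centredQuadForm (Matrix.of p.2) p.1 := by
  simp only [centredQuadForm, dotProduct, Matrix.mulVec, Matrix.trace, Matrix.diag_apply,
    Matrix.of_apply]
  fun_prop

lemma measurable_quadFormVariance (κ : ι → ℝ) :
    Measurable fun b : ι → ι → ℝ => quadFormVariance κ (Matrix.of b) := by
  simp only [quadFormVariance, Matrix.trace, Matrix.diag_apply, Matrix.mul_apply,
    Matrix.transpose_apply, Matrix.of_apply]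
  fun_prop

variable [DecidableEq ι] {z : ι → Ω → ℝ} {m : ℝ} [IsProbabilityMeasure P]

omit [DecidableEq ι] in
lemma integrable_exp_neg_quadFormVariance (hz : ∀ i, IsStandardized (z i) P m)
    (hind : iIndepFun z P) (hA : Measurable fun ω i j => A ω i j)
    (hsymm : ∀ᵐ ω ∂P, (A ω).IsSymm) (t : ℝ) :
    Integrable (fun ω =>
      Real.exp (-(t ^ 2 * quadFormVariance (fun i => kappa4 P (z i)) (A ω)) / 2)) P := by
  classical
  have hV := (measurable_quadFormVariance fun i => kappa4 P (z i)).comp hA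
  refine .of_bound ((hV.const_mul (t ^ 2)).neg.div_const 2).exp.aestronglyMeasurable 1 ?_
  filter_upwards [hsymm] with ω hω
  have := quadFormVariance_kappa4_nonneg hz hind hω
  rw [Real.norm_eq_abs, Real.abs_exp, Real.exp_le_one_iff, neg_div]
  exact neg_nonpos.2 (by positivity)

lemma norm_integral_exp_centredQuadForm_sub_integral_exp_le (hz : ∀ i, IsStandardized (z i) P m)
    (hind : iIndepFun z P) (hm : 1 ≤ m) (hA : Measurable fun ω i j => A ω i j)
    (hAz : IndepFun (fun ω i j => A ω i j) (fun ω i => z i ω) P)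
    (hsymm : ∀ᵐ ω ∂P, (A ω).IsSymm) {C L t : ℝ} (hC0 : 0 < C) (hC : ∀ᵐ ω ∂P, ‖A ω‖ ≤ C)
    (hL : 0 ≤ L) (ht : 0 ≤ t) :
    ‖∫ ω, Complex.exp ((t * centredQuadForm (A ω) fun i => z i ω : ℝ) * Complex.I) ∂P -
        (∫ ω, Real.exp (-(t ^ 2 * quadFormVariance (fun i => kappa4 P (z i)) (A ω)) / 2) ∂P :
          ℝ)‖ ≤
      (Fintype.card ι * t ^ 2 * (3080 * m ^ 2 * C ^ 3 + 16 * m * C ^ 3 * L) +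
        t * (8 * C ^ 2 * ∑ k, lindebergTail P (z k) L +
          19 * m * C ^ 2 * √(Fintype.card ι))) * t := by
  set v : (ι → ι → ℝ) → ℂ := fun b =>
    (Real.exp (-(t ^ 2 * quadFormVariance (fun i => kappa4 P (z i)) (Matrix.of b)) / 2) : ℝ)
  set e : (ι → ℝ) × (ι → ι → ℝ) → ℂ := fun p =>
    Complex.exp ((t * centredQuadForm (Matrix.of p.2) p.1 : ℝ) * Complex.I)
  have hzm : Measurable fun ω i => z i ω := measurable_pi_lambda _ fun i => (hz i).measurable
  have hv : Measurable v := by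
    have := measurable_quadFormVariance fun i => kappa4 P (z i)
    fun_prop
  have he : Measurable e := by
    have := measurable_uncurry_centredQuadForm (ι := ι)
    fun_prop
  have hei {X : Ω → (ι → ℝ) × (ι → ι → ℝ)} (hX : Measurable X) :
      Integrable (fun ω => e (X ω)) P :=
    .of_bound (he.comp hX).aestronglyMeasurable 1
      (.of_forall fun _ => (Complex.norm_exp_ofReal_mul_I _).le)
  have hvi : Integrable (fun ω => v (A ω)) P :=
    (integrable_exp_neg_quadFormVariance hz hind hA hsymm t).ofReal
  have hfubini := integral_eq_integral_integral_of_indepFun hAz.symm hzm hA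
    (F := fun p => e p - v p.2) (by fun_prop) ((hei (hzm.prodMk hA)).sub hvi)
  rw [← integral_complex_ofReal]
  change ‖∫ ω, e (fun i => z i ω, A ω) ∂P - ∫ ω, v (A ω) ∂P‖ ≤ _
  rw [← integral_sub (hei (hzm.prodMk hA)) hvi, hfubini]
  refine (norm_integral_le_of_norm_le_const ?_).trans_eq (by rw [probReal_univ, mul_one])
  filter_upwards [hsymm, hC] with ω hω hωC
  rw [integral_sub (hei (hzm.prodMk measurable_const)) (integrable_const _), integral_const,
    probReal_univ, one_smul]
  exact norm_integral_exp_centredQuadForm_sub_le hz hind hm hω hC0 hωC hL ht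

lemma norm_integral_exp_sub_integral_exp_le_of_card_le (hz : ∀ i, IsStandardized (z i) P m)
    (hind : iIndepFun z P) (hm : 1 ≤ m) (hA : Measurable fun ω i j => A ω i j)
    (hAz : IndepFun (fun ω i j => A ω i j) (fun ω i => z i ω) P)
    (hsymm : ∀ᵐ ω ∂P, (A ω).IsSymm) {C R n ε : ℝ} (hC0 : 0 < C) (hC : ∀ᵐ ω ∂P, ‖A ω‖ ≤ C)
    (hn : 0 < n) (hR : Fintype.card ι ≤ R * n) (hε : 0 ≤ ε) :
    ‖∫ ω, Complex.exp ((1 / √n * centredQuadForm (A ω) fun i => z i ω : ℝ) * Complex.I) ∂P -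
        (∫ ω, Real.exp (-(1 / n * quadFormVariance (fun i => kappa4 P (z i)) (A ω)) / 2) ∂P :
          ℝ)‖ ≤
      (3080 * R * m ^ 2 * C ^ 3 + 19 * m * C ^ 2 * √R) * (1 / √n) + 16 * R * m * C ^ 3 * ε +
        8 * C ^ 2 * (1 / n * ∑ k, lindebergTail P (z k) (ε * √n)) := by
  have hn' : 0 < √n := Real.sqrt_pos.2 hn
  have hcard : √(Fintype.card ι) ≤ √R * √n := by
    rw [← Real.sqrt_mul' _ hn.le]
    exact Real.sqrt_le_sqrt hR
  have hbound := norm_integral_exp_centredQuadForm_sub_integral_exp_le hz hind hm hA hAz hsymm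
    hC0 hC (by positivity : 0 ≤ ε * √n) (by positivity : 0 ≤ 1 / √n)
  rw [div_pow, one_pow, Real.sq_sqrt hn.le] at hbound
  calc _ ≤ _ := hbound
    _ ≤ (R * n * (1 / n) * (3080 * m ^ 2 * C ^ 3 + 16 * m * C ^ 3 * (ε * √n)) +
        1 / √n * (8 * C ^ 2 * ∑ k, lindebergTail P (z k) (ε * √n) +
          19 * m * C ^ 2 * (√R * √n))) * (1 / √n) := by gcongr
    _ = _ := by
        have hsq : n = √n ^ 2 := (Real.sq_sqrt hn.le).symm
        rw [hsq, Real.sqrt_sq hn'.le]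
        field_simp
        ring

end RandomMatrix

section TriangularArray

open scoped Matrix Matrix.Norms.L2Operator

lemma tendsto_zero_of_eventually_norm_le {α E : Type*} [SeminormedAddCommGroup E] {l : Filter α}
    {f : α → E} {η : ℝ → α → ℝ} {K : ℝ} (hf : ∀ ε > 0, ∀ᶠ x in l, ‖f x‖ ≤ η ε x)
    (hη : ∀ ε > 0, Tendsto (η ε) l (𝓝 (K * ε))) : Tendsto f l (𝓝 0) := by
  refine Metric.tendsto_nhds.2 fun δ hδ => ?_
  have hε : 0 < δ / (|K| + 1) := by positivity
  have hlt : K * (δ / (|K| + 1)) < δ := by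
    rw [mul_div_assoc', div_lt_iff₀ (by positivity)]
    nlinarith [le_abs_self K]
  filter_upwards [hf _ hε, (hη _ hε).eventually_lt_const hlt] with x hx hxδ
  simpa using hx.trans_lt hxδ

variable {Ω : ℕ → Type*} [∀ N, MeasurableSpace (Ω N)] {P : ∀ N, Measure (Ω N)}
  [∀ N, IsProbabilityMeasure (P N)]

lemma TendstoInProbConst.tendsto_integral_exp_neg_half {X : ∀ N, Ω N → ℝ} {c : ℝ}
    (hX : TendstoInProbConst P X c) (hXm : ∀ N, Measurable (X N))
    (hX0 : ∀ N, ∀ᵐ ω ∂(P N), 0 ≤ X N ω) :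
    Tendsto (fun N => ∫ ω, Real.exp (-X N ω / 2) ∂(P N)) atTop (𝓝 (Real.exp (-c / 2))) := by
  have hlim := hX.tendsto_integral_comp hXm (f := fun x => Real.exp (-max x 0 / 2))
    (by fun_prop) (M := 1) fun x => by
      rw [Real.abs_exp, Real.exp_le_one_iff, neg_div]
      exact neg_nonpos.2 (by positivity)
  simp only [max_eq_left (hX.nonneg hX0)] at hlim
  refine hlim.congr fun N => integral_congr_ae ?_
  filter_upwards [hX0 N] with ω hω
  rw [max_eq_left hω]

variable {ι : ℕ → Type*} [∀ N, Fintype (ι N)] [∀ N, DecidableEq (ι N)]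
  {z : ∀ N, ι N → Ω N → ℝ} {A : ∀ N, Ω N → Matrix (ι N) (ι N) ℝ} {m C R v : ℝ}

theorem tendsto_integral_exp_centredQuadForm (hz : ∀ N i, IsStandardized (z N i) (P N) m)
    (hind : ∀ N, iIndepFun (z N) (P N)) (hm : 1 ≤ m)
    (hA : ∀ N, Measurable fun ω i j => A N ω i j)
    (hAz : ∀ N, IndepFun (fun ω i j => A N ω i j) (fun ω i => z N i ω) (P N))
    (hsymm : ∀ N, ∀ᵐ ω ∂(P N), (A N ω).IsSymm) (hC0 : 0 < C)
    (hC : ∀ N, ∀ᵐ ω ∂(P N), ‖A N ω‖ ≤ C) (hR : ∀ N, (Fintype.card (ι N) : ℝ) ≤ R * N)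
    (hlind : ∀ ε > 0, Tendsto
      (fun N : ℕ => 1 / (N : ℝ) * ∑ k, lindebergTail (P N) (z N k) (ε * √N)) atTop (𝓝 0))
    (hv : TendstoInProbConst P
      (fun N ω => 1 / (N : ℝ) * quadFormVariance (fun i => kappa4 (P N) (z N i)) (A N ω)) v) :
    Tendsto (fun N : ℕ => ∫ ω, Complex.exp
      ((1 / √N * centredQuadForm (A N ω) fun i => z N i ω : ℝ) * Complex.I) ∂(P N))
      atTop (𝓝 (Real.exp (-v / 2) : ℝ)) := by
  have hvar := hv.tendsto_integral_exp_neg_half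
    (fun N => ((measurable_quadFormVariance fun i => kappa4 (P N) (z N i)).comp (hA N)).const_mul _)
    fun N => by
      filter_upwards [hsymm N] with ω hω
      exact mul_nonneg (by positivity) (quadFormVariance_kappa4_nonneg (hz N) (hind N) hω)
  have hrate (ε : ℝ) (hε : 0 < ε) : Tendsto (fun N : ℕ =>
      (3080 * R * m ^ 2 * C ^ 3 + 19 * m * C ^ 2 * √R) * (1 / √N) + 16 * R * m * C ^ 3 * ε +
        8 * C ^ 2 * (1 / (N : ℝ) * ∑ k, lindebergTail (P N) (z N k) (ε * √N)))
      atTop (𝓝 (16 * R * m * C ^ 3 * ε)) := by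
    have hsqrt : Tendsto (fun N : ℕ => 1 / √(N : ℝ)) atTop (𝓝 0) :=
      tendsto_const_nhds.div_atTop (Real.tendsto_sqrt_atTop.comp tendsto_natCast_atTop_atTop)
    simpa using ((hsqrt.const_mul _).add_const _).add ((hlind ε hε).const_mul (8 * C ^ 2))
  have hdiff := tendsto_zero_of_eventually_norm_le (fun ε hε => ?_) hrate
    (f := fun N : ℕ => ∫ ω, Complex.exp
      ((1 / √N * centredQuadForm (A N ω) fun i => z N i ω : ℝ) * Complex.I) ∂(P N) -
        (∫ ω, Real.exp (-(1 / (N : ℝ) *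
          quadFormVariance (fun i => kappa4 (P N) (z N i)) (A N ω)) / 2) ∂(P N) : ℝ))
  · simpa using hdiff.add ((Complex.continuous_ofReal.tendsto _).comp hvar)
  · filter_upwards [eventually_gt_atTop 0] with N hN
    exact norm_integral_exp_sub_integral_exp_le_of_card_le (hz N) (hind N) hm (hA N) (hAz N)
      (hsymm N) hC0 (hC N) (Nat.cast_pos.2 hN) (hR N) hε.le

end TriangularArray

section Block

open scoped Matrix Matrix.Norms.L2Operator

variable {σ ι : Type*}

lemma isSymm_comp {b : Matrix σ σ (Matrix ι ι ℝ)} (hb : ∀ s t, (b s t)ᵀ = b t s) :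
    (Matrix.comp σ σ ι ι ℝ b).IsSymm := by
  ext p q
  rw [Matrix.transpose_apply, Matrix.comp_apply, Matrix.comp_apply, ← hb p.1 q.1,
    Matrix.transpose_apply]

section Inclusion

variable [DecidableEq σ] [DecidableEq ι]

/-- The isometric inclusion of the coordinates with first index `s`; conjugation by inclusions
places a matrix as a single block. -/
def blockInclusion (ι : Type*) [DecidableEq ι] (s : σ) : Matrix (σ × ι) ι ℝ :=
  (1 : Matrix (σ × ι) (σ × ι) ℝ).submatrix id (Prod.mk s)

lemma comp_single_eq_mul [Fintype ι] (s t : σ) (M : Matrix ι ι ℝ) :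
    Matrix.comp σ σ ι ι ℝ (Matrix.single s t M) =
      blockInclusion ι s * M * (blockInclusion ι t)ᴴ := by
  ext ⟨u, i⟩ ⟨w, j⟩
  by_cases hu : s = u <;> by_cases hw : t = w <;>
    simp [blockInclusion, Matrix.mul_apply, Matrix.one_apply, Matrix.single, hu, hw,
      eq_comm (a := u), eq_comm (a := w)]

end Inclusion

variable [Fintype σ] [Fintype ι]

lemma quadFormVariance_comp (κ : σ × ι → ℝ) (b : Matrix σ σ (Matrix ι ι ℝ)) :
    quadFormVariance κ (Matrix.comp σ σ ι ι ℝ b) =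
      ∑ s, ∑ i, b s s i i ^ 2 * κ (s, i) + 2 * ∑ s, ∑ t, ((b s t)ᵀ * b s t).trace := by
  simp only [quadFormVariance, trace_transpose_mul_self_eq_sum, Matrix.comp_apply,
    Fintype.sum_prod_type]
  congr 2
  exact Finset.sum_congr rfl fun s _ => Finset.sum_comm

variable [DecidableEq σ]

lemma centredQuadForm_comp (b : Matrix σ σ (Matrix ι ι ℝ)) (x : σ × ι → ℝ) :
    centredQuadForm (Matrix.comp σ σ ι ι ℝ b) x =
      ∑ s, ∑ t, ((fun i => x (s, i)) ⬝ᵥ b s t *ᵥ (fun i => x (t, i)) -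
        if s = t then (b s t).trace else 0) := by
  simp only [centredQuadForm, Matrix.trace, Matrix.diag_apply, dotProduct, Matrix.mulVec,
    Matrix.comp_apply, Fintype.sum_prod_type, Finset.sum_sub_distrib, Finset.sum_ite_eq,
    Finset.mem_univ, if_true, Finset.mul_sum]
  congr 1
  exact Finset.sum_congr rfl fun s _ => Finset.sum_comm

variable [DecidableEq ι]

lemma norm_blockInclusion_le (s : σ) : ‖blockInclusion ι s‖ ≤ 1 := by
  have hisom : (blockInclusion ι s)ᴴ * blockInclusion ι s = 1 := by
    ext i j
    simp [blockInclusion, Matrix.mul_apply, Matrix.one_apply]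
  have hone : ‖(1 : Matrix ι ι ℝ)‖ ≤ 1 := by
    rw [← Matrix.diagonal_one, Matrix.l2_opNorm_diagonal]
    exact (pi_norm_le_iff_of_nonneg zero_le_one).2 fun _ => norm_one.le
  rw [← hisom, Matrix.l2_opNorm_conjTranspose_mul_self] at hone
  nlinarith [norm_nonneg (blockInclusion ι s)]

lemma norm_comp_le (b : Matrix σ σ (Matrix ι ι ℝ)) :
    ‖Matrix.comp σ σ ι ι ℝ b‖ ≤ ∑ s, ∑ t, ‖b s t‖ := by
  have hsum : Matrix.comp σ σ ι ι ℝ b =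
      ∑ s, ∑ t, Matrix.comp σ σ ι ι ℝ (Matrix.single s t (b s t)) := by
    conv_lhs => rw [Matrix.matrix_eq_sum_single b]
    simp only [← Matrix.compAddEquiv_apply, map_sum]
  have hblock (s t : σ) : ‖Matrix.comp σ σ ι ι ℝ (Matrix.single s t (b s t))‖ ≤ ‖b s t‖ := by
    rw [comp_single_eq_mul]
    calc _ ≤ ‖blockInclusion ι s‖ * ‖b s t‖ * ‖(blockInclusion ι t)ᴴ‖ :=
          (Matrix.l2_opNorm_mul _ _).trans (by gcongr; exact Matrix.l2_opNorm_mul _ _)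
      _ ≤ 1 * ‖b s t‖ * 1 := by
          rw [Matrix.l2_opNorm_conjTranspose]
          gcongr <;> exact norm_blockInclusion_le _
      _ = ‖b s t‖ := by rw [one_mul, mul_one]
  rw [hsum]
  exact norm_sum_le_of_le _ fun s _ => norm_sum_le_of_le _ fun t _ => hblock s t

lemma norm_comp_smul_le {b : σ → σ → Matrix ι ι ℝ} {a : ℝ} (hb : ∀ s t, ‖b s t‖ ≤ a)
    (c : σ → σ → ℝ) :
    ‖Matrix.comp _ _ _ _ ℝ (Matrix.of fun s t => c s t • b s t)‖ ≤
      ∑ s, ∑ t, |c s t| * a := by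
  refine (norm_comp_le _).trans (Finset.sum_le_sum fun s _ => Finset.sum_le_sum fun t _ => ?_)
  rw [Matrix.of_apply, norm_smul, Real.norm_eq_abs]
  gcongr
  exact hb s t

end Block

section SymmetricArray

variable {σ α : Type*} [LinearOrder σ]

/-- The symmetric array with entries on and above the diagonal given by `x`. -/
def symmOfUpper (x : {p : σ × σ // p.1 ≤ p.2} → α) (s t : σ) : α :=
  x ⟨(min s t, max s t), min_le_max⟩

lemma symmOfUpper_comm (x : {p : σ × σ // p.1 ≤ p.2} → α) (s t : σ) :
    symmOfUpper x s t = symmOfUpper x t s := by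
  simp only [symmOfUpper, min_comm s t, max_comm s t]

lemma symmOfUpper_apply (x : {p : σ × σ // p.1 ≤ p.2} → α) (p : {p : σ × σ // p.1 ≤ p.2}) :
    symmOfUpper x p.1.1 p.1.2 = x p :=
  congrArg x (Subtype.ext (Prod.ext (min_eq_left p.2) (max_eq_right p.2)))

lemma symmOfUpper_restrict {F : σ → σ → α} (hF : ∀ s t, F s t = F t s) (s t : σ) :
    symmOfUpper (fun p => F p.1.1 p.1.2) s t = F s t := by
  rcases le_total s t with h | h
  · simp [symmOfUpper, h]
  · simp [symmOfUpper, h, hF t s]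

lemma sum_sum_eq_sum_upper {M : Type*} [AddCommMonoid M] [Fintype σ] {F : σ → σ → M}
    (hF : ∀ s t, F s t = F t s) :
    ∑ s, ∑ t, F s t = ∑ p : {p : σ × σ // p.1 ≤ p.2},
      (if p.1.1 = p.1.2 then 1 else 2) • F p.1.1 p.1.2 := by
  have hlower : ∑ x : σ × σ, (if x.2 < x.1 then F x.1 x.2 else 0) =
      ∑ x : σ × σ, if x.1 < x.2 then F x.1 x.2 else 0 := by
    rw [← Equiv.sum_comp (Equiv.prodComm σ σ)]
    simp [hF]
  calc ∑ s, ∑ t, F s t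
      = ∑ x : σ × σ, ((if x.1 ≤ x.2 then F x.1 x.2 else 0) +
          if x.2 < x.1 then F x.1 x.2 else 0) := by
        rw [← Fintype.sum_prod_type']
        refine Finset.sum_congr rfl fun x _ => ?_
        rcases le_or_gt x.1 x.2 with h | h
        · simp [h, not_lt.2 h]
        · simp [h, not_le.2 h]
    _ = ∑ x : σ × σ, if x.1 ≤ x.2 then (if x.1 = x.2 then 1 else 2) • F x.1 x.2 else 0 := by
        rw [Finset.sum_add_distrib, hlower, ← Finset.sum_add_distrib]
        refine Finset.sum_congr rfl fun x _ => ?_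
        rcases lt_trichotomy x.1 x.2 with h | h | h
        · simp [h, h.le, h.ne, two_nsmul]
        · simp [h]
        · simp [not_le.2 h, not_lt.2 h.le]
    _ = _ := by
        rw [← Finset.sum_filter]
        exact Finset.sum_subtype _ (by simp) _

end SymmetricArray

section Gaussian

lemma integral_exp_sum_pi_gaussianReal {κ : Type*} [Fintype κ] (v : κ → NNReal) (w : κ → ℝ) :
    ∫ x, Complex.exp ((∑ p, w p * x p : ℝ) * Complex.I)
        ∂(Measure.pi fun p => gaussianReal 0 (v p)) =
      Real.exp (-(∑ p, w p ^ 2 * v p) / 2) := by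
  have hfactor (p : κ) : ∫ x : ℝ, Complex.exp (w p * x * Complex.I) ∂(gaussianReal 0 (v p)) =
      Complex.exp (-(w p ^ 2 * v p) / 2) := by
    rw [← charFun_apply_real, charFun_gaussianReal]
    congr 1
    push_cast
    ring
  calc _ = ∫ x : κ → ℝ, ∏ p, Complex.exp (w p * x p * Complex.I)
        ∂(Measure.pi fun p => gaussianReal 0 (v p)) := by
        simp only [← Complex.exp_sum, Complex.ofReal_sum, Complex.ofReal_mul, Finset.sum_mul]
    _ = ∏ p, Complex.exp (-(w p ^ 2 * v p) / 2) := by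
        rw [integral_fintype_prod_eq_prod (𝕜 := ℂ)
          fun p (x : ℝ) => Complex.exp (w p * x * Complex.I)]
        simp only [hfactor]
    _ = _ := by
        rw [← Complex.exp_sum]
        push_cast
        rw [← Finset.sum_div, Finset.sum_neg_distrib]

lemma hasLaw_symmOfUpper_pi_gaussianReal {σ : Type*} [LinearOrder σ] [Fintype σ]
    (v : {p : σ × σ // p.1 ≤ p.2} → NNReal) (s t : σ) :
    HasLaw (fun x => symmOfUpper x s t) (gaussianReal 0 (symmOfUpper v s t))
      (Measure.pi fun p => gaussianReal 0 (v p)) :=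
  (measurePreserving_eval (fun p => gaussianReal 0 (v p)) _).hasLaw

lemma charFun_map_toLp {κ Ω : Type*} [Fintype κ] [MeasurableSpace Ω] {P : Measure Ω}
    {X : Ω → κ → ℝ} (hX : Measurable X) (t : EuclideanSpace ℝ κ) :
    charFun (P.map fun ω => (WithLp.toLp 2 (X ω) : EuclideanSpace ℝ κ)) t =
      ∫ ω, Complex.exp ((∑ k, t k * X ω k : ℝ) * Complex.I) ∂P := by
  have htoLp : Measurable (WithLp.toLp 2 : (κ → ℝ) → EuclideanSpace ℝ κ) :=
    (PiLp.continuous_toLp 2 _).measurable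
  rw [charFun_apply, integral_map (φ := fun ω => (WithLp.toLp 2 (X ω) : EuclideanSpace ℝ κ))
    (htoLp.comp hX).aemeasurable (by fun_prop : Continuous _).aestronglyMeasurable]
  simp [PiLp.inner_apply]

lemma tendstoInDistribution_of_tendsto_integral_exp {κ : Type*} [Fintype κ]
    {Ω : ℕ → Type*} [∀ N, MeasurableSpace (Ω N)] {P : ∀ N, Measure (Ω N)}
    [∀ N, IsProbabilityMeasure (P N)] {Ω' : Type*} [MeasurableSpace Ω'] {P' : Measure Ω'}
    [IsProbabilityMeasure P'] {X : ∀ N, Ω N → κ → ℝ} {G : Ω' → κ → ℝ}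
    (hX : ∀ N, Measurable (X N)) (hG : Measurable G)
    (h : ∀ θ : κ → ℝ, Tendsto (fun N => ∫ ω, Complex.exp ((∑ k, θ k * X N ω k : ℝ) * Complex.I)
      ∂(P N)) atTop (𝓝 (∫ ω, Complex.exp ((∑ k, θ k * G ω k : ℝ) * Complex.I) ∂P'))) :
    TendstoInDistribution X atTop G P P' := by
  have htoLp : Measurable (WithLp.toLp 2 : (κ → ℝ) → EuclideanSpace ℝ κ) :=
    (PiLp.continuous_toLp 2 _).measurable
  have hE : TendstoInDistribution (fun N ω => (WithLp.toLp 2 (X N ω) : EuclideanSpace ℝ κ)) atTop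
      (fun ω => WithLp.toLp 2 (G ω)) P P' := by
    refine ⟨fun N => (htoLp.comp (hX N)).aemeasurable, (htoLp.comp hG).aemeasurable,
      ProbabilityMeasure.tendsto_iff_tendsto_charFun.2 fun t => ?_⟩
    simp only [ProbabilityMeasure.coe_mk, charFun_map_toLp hG, charFun_map_toLp (hX _)]
    exact h t
  exact hE.continuous_comp (PiLp.continuous_ofLp 2 _)

theorem tendstoInDistribution_symmOfUpper_gaussian {σ : Type*} [LinearOrder σ] [Fintype σ]
    {Ω : ℕ → Type*} [∀ N, MeasurableSpace (Ω N)] {P : ∀ N, Measure (Ω N)}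
    [∀ N, IsProbabilityMeasure (P N)] {Q : ∀ N, Ω N → σ → σ → ℝ} (hQ : ∀ N, Measurable (Q N))
    (hQ_comm : ∀ N, ∀ᵐ ω ∂(P N), ∀ s t, Q N ω s t = Q N ω t s) {V : σ → σ → ℝ}
    (hV : ∀ s t, 0 ≤ V s t)
    (h : ∀ c : σ → σ → ℝ, (∀ s t, c s t = c t s) → Tendsto
      (fun N => ∫ ω, Complex.exp ((∑ s, ∑ t, c s t * Q N ω s t : ℝ) * Complex.I) ∂(P N)) atTop
      (𝓝 (Real.exp (-(∑ p : {p : σ × σ // p.1 ≤ p.2}, ((if p.1.1 = p.1.2 then 1 else 2) *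
        c p.1.1 p.1.2) ^ 2 * V p.1.1 p.1.2) / 2) : ℝ))) :
    TendstoInDistribution Q atTop symmOfUpper P
      (Measure.pi fun p : {p : σ × σ // p.1 ≤ p.2} =>
        gaussianReal 0 (V p.1.1 p.1.2).toNNReal) := by
  have hupper : TendstoInDistribution (fun N ω (p : {p : σ × σ // p.1 ≤ p.2}) =>
      Q N ω p.1.1 p.1.2) atTop (fun x => x) P
      (Measure.pi fun p => gaussianReal 0 (V p.1.1 p.1.2).toNNReal) := by
    refine tendstoInDistribution_of_tendsto_integral_exp (fun N => by fun_prop) measurable_id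
      fun θ => ?_
    set c := symmOfUpper fun p : {p : σ × σ // p.1 ≤ p.2} =>
      θ p / (if p.1.1 = p.1.2 then 1 else 2) with hc
    have hcθ (p : {p : σ × σ // p.1 ≤ p.2}) :
        (if p.1.1 = p.1.2 then 1 else 2) * c p.1.1 p.1.2 = θ p := by
      rw [hc, symmOfUpper_apply]
      split_ifs <;> ring
    have hc_comm : ∀ s t, c s t = c t s := symmOfUpper_comm _
    have hlim := h c hc_comm
    simp only [hcθ] at hlim
    simp only [integral_exp_sum_pi_gaussianReal, Real.coe_toNNReal _ (hV _ _)]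
    refine hlim.congr fun N => integral_congr_ae ?_
    filter_upwards [hQ_comm N] with ω hω
    rw [sum_sum_eq_sum_upper fun s t => by rw [hc_comm s t, hω s t]]
    simp only [nsmul_eq_mul, ← mul_assoc, Nat.cast_ite, Nat.cast_one, Nat.cast_ofNat, hcθ]
  refine (hupper.continuous_comp (g := symmOfUpper) ?_).congr (fun N => ?_) .rfl
  · exact continuous_pi fun s => continuous_pi fun t => continuous_apply _
  · filter_upwards [hQ_comm N] with ω hω
    exact funext fun s => funext fun t => symmOfUpper_restrict hω s t

end Gaussian

section QuadFormMatrix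

open scoped Matrix Matrix.Norms.L2Operator

variable {Ω : Type*} {r N : ℕ} {y : Fin r → Fin N → Ω → ℝ}
  {B : Fin r → Fin r → Ω → Matrix (Fin N) (Fin N) ℝ}

lemma sum_mul_quadFormMatrix (c : Fin r → Fin r → ℝ) (ω : Ω) :
    ∑ s, ∑ t, c s t * quadFormMatrix y B ω s t =
      1 / √N * centredQuadForm
        (Matrix.comp _ _ _ _ ℝ (Matrix.of fun s t => c s t • B s t ω)) fun p => y p.1 p.2 ω := by
  simp only [centredQuadForm_comp, quadFormMatrix, Finset.mul_sum]
  refine Finset.sum_congr rfl fun s _ => Finset.sum_congr rfl fun t _ => ?_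
  rw [Matrix.of_apply, Matrix.smul_mulVec, dotProduct_smul, Matrix.trace_smul, smul_eq_mul,
    smul_eq_mul]
  split_ifs <;> ring

lemma quadFormMatrix_comm {ω : Ω} (h : ∀ s t, (B s t ω)ᵀ = B t s ω) (s t : Fin r) :
    quadFormMatrix y B ω s t = quadFormMatrix y B ω t s := by
  unfold quadFormMatrix
  congr 2
  · rw [← h s t, Matrix.mulVec_transpose, Matrix.dotProduct_mulVec, dotProduct_comm]
  · rcases eq_or_ne s t with rfl | hst
    · rfl
    · rw [if_neg hst, if_neg hst.symm]

lemma measurable_quadFormMatrix [MeasurableSpace Ω] (hy : ∀ s j, Measurable (y s j))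
    (hB : ∀ s t i j, Measurable fun ω => B s t ω i j) : Measurable (quadFormMatrix y B) := by
  refine measurable_pi_lambda _ fun s => measurable_pi_lambda _ fun t => .const_mul (.sub ?_ ?_) _
  · simp only [dotProduct, Matrix.mulVec]
    fun_prop
  · split_ifs
    · simp only [Matrix.trace, Matrix.diag_apply]
      fun_prop
    · fun_prop

end QuadFormMatrix

section Limit

open scoped Matrix Matrix.Norms.L2Operator

variable {r : ℕ} {a₁ : Fin r → ℝ} {a₂ : Fin r → Fin r → ℝ}

/-- The variance of the `(s, t)` entry of the limiting Gaussian matrix. -/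
def entryVariance (a₁ : Fin r → ℝ) (a₂ : Fin r → Fin r → ℝ) (s t : Fin r) : ℝ :=
  if s = t then a₁ s + 2 * a₂ s s else a₂ s t

lemma entryVariance_comm (h : ∀ s t, a₂ s t = a₂ t s) (s t : Fin r) :
    entryVariance a₁ a₂ s t = entryVariance a₁ a₂ t s := by
  rcases eq_or_ne s t with rfl | hst
  · rfl
  · rw [entryVariance, entryVariance, if_neg hst, if_neg hst.symm, h]

lemma sum_sq_mul_entryVariance {c : Fin r → Fin r → ℝ} (hc : ∀ s t, c s t = c t s)
    (h : ∀ s t, a₂ s t = a₂ t s) :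
    ∑ s, c s s ^ 2 * a₁ s + 2 * ∑ s, ∑ t, c s t ^ 2 * a₂ s t =
      ∑ p : {p : Fin r × Fin r // p.1 ≤ p.2}, ((if p.1.1 = p.1.2 then 1 else 2) *
        c p.1.1 p.1.2) ^ 2 * entryVariance a₁ a₂ p.1.1 p.1.2 := by
  have hdiag : ∑ s, c s s ^ 2 * a₁ s = ∑ s, ∑ t, if s = t then c s t ^ 2 * a₁ s else 0 := by simp
  rw [hdiag, Finset.mul_sum, ← Finset.sum_add_distrib]
  simp only [Finset.mul_sum, ← Finset.sum_add_distrib]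
  rw [sum_sum_eq_sum_upper fun s t => ?_]
  · refine Finset.sum_congr rfl fun p _ => ?_
    rw [entryVariance, nsmul_eq_mul]
    split_ifs with hp
    · rw [← hp]; push_cast; ring
    · push_cast; ring
  · rcases eq_or_ne s t with rfl | hst
    · rfl
    · rw [if_neg hst, if_neg hst.symm, hc, h]

variable {Ω : ℕ → Type*} [∀ N, MeasurableSpace (Ω N)] {P : ∀ N, Measure (Ω N)}
  {y : ∀ N, Fin r → Fin N → Ω N → ℝ}
  {B : ∀ N, Fin r → Fin r → Ω N → Matrix (Fin N) (Fin N) ℝ}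

lemma TendstoInProbConst.quadFormVariance_comp_smul
    (h_a₂ : ∀ s t, TendstoInProbConst P
      (fun N ω => 1 / (N : ℝ) * ((B N s t ω)ᵀ * B N s t ω).trace) (a₂ s t))
    (h_a₁ : ∀ s, TendstoInProbConst P
      (fun N ω => 1 / (N : ℝ) * ∑ i, B N s s ω i i ^ 2 * kappa4 (P N) (y N s i)) (a₁ s))
    (c : Fin r → Fin r → ℝ) :
    TendstoInProbConst P (fun N ω => 1 / (N : ℝ) *
      quadFormVariance (fun p => kappa4 (P N) (y N p.1 p.2))
        (Matrix.comp _ _ _ _ ℝ (Matrix.of fun s t => c s t • B N s t ω)))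
      (∑ s, c s s ^ 2 * a₁ s + 2 * ∑ s, ∑ t, c s t ^ 2 * a₂ s t) := by
  have h := (TendstoInProbConst.sum Finset.univ fun s _ => (h_a₁ s).const_mul (c s s ^ 2)).add
    ((TendstoInProbConst.sum Finset.univ fun s _ => TendstoInProbConst.sum Finset.univ
      fun t _ => (h_a₂ s t).const_mul (c s t ^ 2)).const_mul 2)
  refine h.congr fun N => .of_forall fun ω => ?_
  simp only [quadFormVariance_comp, Matrix.of_apply, Matrix.smul_apply, Matrix.transpose_smul,
    Matrix.smul_mul, Matrix.mul_smul, Matrix.trace_smul, smul_eq_mul, Finset.mul_sum, mul_add]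
  congr 1
  · exact Finset.sum_congr rfl fun s _ => Finset.sum_congr rfl fun i _ => by ring
  · exact Finset.sum_congr rfl fun s _ => Finset.sum_congr rfl fun t _ => by ring

variable [∀ N, IsProbabilityMeasure (P N)] {m a : ℝ}

lemma trace_limit_comm (hB_symm : ∀ N s t, ∀ᵐ ω ∂(P N), (B N s t ω)ᵀ = B N t s ω)
    (h_a₂ : ∀ s t, TendstoInProbConst P
      (fun N ω => 1 / (N : ℝ) * ((B N s t ω)ᵀ * B N s t ω).trace) (a₂ s t)) (s t : Fin r) :
    a₂ s t = a₂ t s := by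
  refine (h_a₂ s t).unique ((h_a₂ t s).congr fun N => ?_)
  filter_upwards [hB_symm N s t] with ω hω
  rw [← hω, Matrix.transpose_transpose, Matrix.trace_mul_comm]

lemma entryVariance_nonneg (hy : ∀ N s j, IsStandardized (y N s j) (P N) m)
    (hy_indep : ∀ N, iIndepFun (fun p : Fin r × Fin N => y N p.1 p.2) (P N))
    (hB_symm : ∀ N s t, ∀ᵐ ω ∂(P N), (B N s t ω)ᵀ = B N t s ω)
    (h_a₂ : ∀ s t, TendstoInProbConst P
      (fun N ω => 1 / (N : ℝ) * ((B N s t ω)ᵀ * B N s t ω).trace) (a₂ s t))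
    (h_a₁ : ∀ s, TendstoInProbConst P
      (fun N ω => 1 / (N : ℝ) * ∑ i, B N s s ω i i ^ 2 * kappa4 (P N) (y N s i)) (a₁ s))
    (s t : Fin r) : 0 ≤ entryVariance a₁ a₂ s t := by
  unfold entryVariance
  split_ifs
  · refine ((h_a₁ s).add ((h_a₂ s s).const_mul 2)).nonneg fun N => ?_
    filter_upwards [hB_symm N s s] with ω hω
    have hind := (hy_indep N).precomp (Prod.mk_right_injective s)
    have := quadFormVariance_kappa4_nonneg (hy N s) hind hω
    calc _ ≤ 1 / (N : ℝ) * quadFormVariance (fun i => kappa4 (P N) (y N s i)) (B N s s ω) := by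
          positivity
      _ = _ := by rw [quadFormVariance]; ring
  · refine (h_a₂ s t).nonneg fun N => .of_forall fun ω => ?_
    rw [trace_transpose_mul_self_eq_sum]
    positivity

theorem tendsto_integral_exp_sum_mul_quadFormMatrix (hm : 1 ≤ m)
    (hy : ∀ N s j, IsStandardized (y N s j) (P N) m)
    (hB_meas : ∀ N s t i j, Measurable (fun ω => B N s t ω i j))
    (hy_indep : ∀ N, iIndepFun (fun p : Fin r × Fin N => y N p.1 p.2) (P N))
    (hBy_indep : ∀ N, IndepFun (fun ω s t i j => B N s t ω i j) (fun ω s j => y N s j ω) (P N))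
    (hB_symm : ∀ N s t, ∀ᵐ ω ∂(P N), (B N s t ω)ᵀ = B N t s ω)
    (h_lind : ∀ s, ∀ ε : ℝ, 0 < ε →
      Tendsto (fun N => lindebergSum (P N) (y N s) ε) atTop (𝓝 0))
    (hB_norm : ∀ N s t, ∀ᵐ ω ∂(P N), ‖B N s t ω‖ ≤ a)
    (h_a₂ : ∀ s t, TendstoInProbConst P
      (fun N ω => 1 / (N : ℝ) * ((B N s t ω)ᵀ * B N s t ω).trace) (a₂ s t))
    (h_a₁ : ∀ s, TendstoInProbConst P
      (fun N ω => 1 / (N : ℝ) * ∑ i, B N s s ω i i ^ 2 * kappa4 (P N) (y N s i)) (a₁ s))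
    {c : Fin r → Fin r → ℝ} (hc : ∀ s t, c s t = c t s) :
    Tendsto (fun N => ∫ ω, Complex.exp
      ((∑ s, ∑ t, c s t * quadFormMatrix (y N) (B N) ω s t : ℝ) * Complex.I) ∂(P N)) atTop
      (𝓝 (Real.exp (-(∑ s, c s s ^ 2 * a₁ s + 2 * ∑ s, ∑ t, c s t ^ 2 * a₂ s t) / 2) : ℝ)) := by
  simp only [sum_mul_quadFormMatrix]
  refine tendsto_integral_exp_centredQuadForm (m := m) (R := r)
    (C := max (∑ s, ∑ t, |c s t| * a) 1) (fun N p => hy N p.1 p.2) hy_indep hm (fun N => ?_)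
    (fun N => ?_) (fun N => ?_) (by positivity) (fun N => ?_) (fun N => by simp)
    (fun ε hε => ?_) (.quadFormVariance_comp_smul h_a₂ h_a₁ c)
  · exact measurable_pi_lambda _ fun p => measurable_pi_lambda _ fun q =>
      (hB_meas N p.1 q.1 p.2 q.2).const_mul _
  · exact (hBy_indep N).comp
      (φ := fun (b : Fin r → Fin r → Fin N → Fin N → ℝ) (p q : Fin r × Fin N) =>
        c p.1 q.1 * b p.1 q.1 p.2 q.2)
      (ψ := fun (u : Fin r → Fin N → ℝ) (p : Fin r × Fin N) => u p.1 p.2) (by fun_prop)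
      (by fun_prop)
  · filter_upwards [ae_all_iff.2 fun s => ae_all_iff.2 (hB_symm N s)] with ω hω
    exact isSymm_comp fun s t => by simp [hω s t, hc s t]
  · filter_upwards [ae_all_iff.2 fun s => ae_all_iff.2 (hB_norm N s)] with ω hω
    exact (norm_comp_smul_le hω c).trans (le_max_left _ _)
  · have h := tendsto_finsetSum Finset.univ fun s _ => h_lind s ε hε
    simp only [lindebergSum, Finset.sum_const_zero, ← Finset.mul_sum] at h
    simpa only [Fintype.sum_prod_type, lindebergTail] using h

theorem tendstoInDistribution_quadFormMatrix (hm : 1 ≤ m)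
    (hy : ∀ N s j, IsStandardized (y N s j) (P N) m)
    (hB_meas : ∀ N s t i j, Measurable (fun ω => B N s t ω i j))
    (hy_indep : ∀ N, iIndepFun (fun p : Fin r × Fin N => y N p.1 p.2) (P N))
    (hBy_indep : ∀ N, IndepFun (fun ω s t i j => B N s t ω i j) (fun ω s j => y N s j ω) (P N))
    (hB_symm : ∀ N s t, ∀ᵐ ω ∂(P N), (B N s t ω)ᵀ = B N t s ω)
    (h_lind : ∀ s, ∀ ε : ℝ, 0 < ε →
      Tendsto (fun N => lindebergSum (P N) (y N s) ε) atTop (𝓝 0))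
    (hB_norm : ∀ N s t, ∀ᵐ ω ∂(P N), ‖B N s t ω‖ ≤ a)
    (h_a₂ : ∀ s t, TendstoInProbConst P
      (fun N ω => 1 / (N : ℝ) * ((B N s t ω)ᵀ * B N s t ω).trace) (a₂ s t))
    (h_a₁ : ∀ s, TendstoInProbConst P
      (fun N ω => 1 / (N : ℝ) * ∑ i, B N s s ω i i ^ 2 * kappa4 (P N) (y N s i)) (a₁ s)) :
    TendstoInDistribution (fun N => quadFormMatrix (y N) (B N)) atTop symmOfUpper P
      (Measure.pi fun p : {p : Fin r × Fin r // p.1 ≤ p.2} =>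
        gaussianReal 0 (entryVariance a₁ a₂ p.1.1 p.1.2).toNNReal) := by
  have hQ (N : ℕ) : Measurable (quadFormMatrix (y N) (B N)) :=
    measurable_quadFormMatrix (fun s j => (hy N s j).measurable) (hB_meas N)
  have hcomm (N : ℕ) : ∀ᵐ ω ∂(P N), ∀ s t,
      quadFormMatrix (y N) (B N) ω s t = quadFormMatrix (y N) (B N) ω t s := by
    filter_upwards [ae_all_iff.2 fun s => ae_all_iff.2 (hB_symm N s)] with ω hω
    exact quadFormMatrix_comm hω
  refine tendstoInDistribution_symmOfUpper_gaussian hQ hcomm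
    (entryVariance_nonneg hy hy_indep hB_symm h_a₂ h_a₁) fun c hc => ?_
  rw [← sum_sq_mul_entryVariance hc (trace_limit_comm hB_symm h_a₂)]
  exact tendsto_integral_exp_sum_mul_quadFormMatrix hm hy hB_meas hy_indep hBy_indep
    hB_symm h_lind hB_norm h_a₂ h_a₁ hc

end Limit

theorem theoremA4 {r : ℕ} {Ω : ℕ → Type*} [∀ N, MeasurableSpace (Ω N)]
    (P : ∀ N, Measure (Ω N)) [∀ N, IsProbabilityMeasure (P N)]
    (y : ∀ N, Fin r → Fin N → Ω N → ℝ)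
    (B : ∀ N, Fin r → Fin r → Ω N → Matrix (Fin N) (Fin N) ℝ)
    (a₁ : Fin r → ℝ) (a₂ : Fin r → Fin r → ℝ) (m₄ a : ℝ)
    -- the entries are random variables
    (hy_meas : ∀ N s j, Measurable (y N s j))
    (hB_meas : ∀ N s t i j, Measurable (fun ω => B N s t ω i j))
    -- the entries of all the vectors are jointly independent and standardized
    (hy_indep : ∀ N, iIndepFun (fun p : Fin r × Fin N => y N p.1 p.2) (P N))
    (hy_mean : ∀ N s j, ∫ ω, y N s j ω ∂(P N) = 0)
    (hy_var : ∀ N s j, variance (y N s j) (P N) = 1)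
    -- with uniformly bounded fourth moments
    (hy_memLp : ∀ N s j, MemLp (y N s j) 4 (P N))
    (hy_four : ∀ N s j, ∫ ω, |y N s j ω| ^ 4 ∂(P N) ≤ m₄)
    -- the family of matrices is independent of the family of vectors
    (hBy_indep : ∀ N, IndepFun
      (fun ω => ((fun s t i j => B N s t ω i j) : Fin r → Fin r → Fin N → Fin N → ℝ))
      (fun ω => ((fun s j => y N s j ω) : Fin r → Fin N → ℝ)) (P N))
    (hB_symm : ∀ N s t, ∀ᵐ ω ∂(P N), (B N s t ω).transpose = B N t s ω)
    -- (i) Lindeberg condition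
    (h_lind : ∀ s, ∀ ε : ℝ, 0 < ε →
      Tendsto (fun N => lindebergSum (P N) (y N s) ε) atTop (𝓝 0))
    -- (ii) bound on the operator norms
    (hB_norm : ∀ N s t, ∀ᵐ ω ∂(P N), ‖Matrix.toEuclideanCLM (𝕜 := ℝ) (B N s t ω)‖ ≤ a)
    -- (iii), (iv) convergence in probability of normalized traces
    (h_a₂ : ∀ s t, TendstoInProbConst P
      (fun N ω => (1 / (N : ℝ)) * ((B N s t ω).transpose * B N s t ω).trace) (a₂ s t))
    (h_a₁ : ∀ s, TendstoInProbConst P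
      (fun N ω => (1 / (N : ℝ)) * ∑ i, (B N s s ω i i) ^ 2 * kappa4 (P N) (y N s i)) (a₁ s)) :
    -- the limiting variances are non-negative
    (∀ s t, s ≠ t → 0 ≤ a₂ s t) ∧ (∀ s, 0 ≤ a₁ s + 2 * a₂ s s) ∧
    ∃ (Ω' : Type) (_ : MeasurableSpace Ω') (P' : Measure Ω') (_ : IsProbabilityMeasure P')
      (G : Ω' → Fin r → Fin r → ℝ),
      (∀ ω s t, G ω s t = G ω t s) ∧
      iIndepFun (fun (p : {p : Fin r × Fin r // p.1 ≤ p.2}) ω => G ω p.1.1 p.1.2) P' ∧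
      (∀ s t, s ≠ t →
        HasLaw (fun ω => G ω s t) (gaussianReal 0 (a₂ s t).toNNReal) P') ∧
      (∀ s, HasLaw (fun ω => G ω s s) (gaussianReal 0 (a₁ s + 2 * a₂ s s).toNNReal) P') ∧
      TendstoInDistribution (fun N => quadFormMatrix (y N) (B N)) atTop G P P' := by
  have hy N s j : IsStandardized (y N s j) (P N) (max m₄ 1) :=
    .of_variance (hy_meas N s j) (hy_memLp N s j) (hy_mean N s j) (hy_var N s j)
      ((hy_four N s j).trans (le_max_left _ _))
  have hV := entryVariance_nonneg hy hy_indep hB_symm h_a₂ h_a₁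
  have hV_comm s t : (entryVariance a₁ a₂ s t).toNNReal = (entryVariance a₁ a₂ t s).toNNReal := by
    rw [entryVariance_comm (trace_limit_comm hB_symm h_a₂)]
  have hlaw := hasLaw_symmOfUpper_pi_gaussianReal fun p : {p : Fin r × Fin r // p.1 ≤ p.2} =>
    (entryVariance a₁ a₂ p.1.1 p.1.2).toNNReal
  simp only [symmOfUpper_restrict hV_comm] at hlaw
  refine ⟨fun s t hst => by simpa [entryVariance, hst] using hV s t,
    fun s => by simpa [entryVariance] using hV s s, _, inferInstance,
    Measure.pi fun p : {p : Fin r × Fin r // p.1 ≤ p.2} =>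
      gaussianReal 0 (entryVariance a₁ a₂ p.1.1 p.1.2).toNNReal,
    inferInstance, symmOfUpper, symmOfUpper_comm, ?_,
    fun s t hst => by simpa [entryVariance, hst] using hlaw s t,
    fun s => by simpa [entryVariance] using hlaw s s,
    tendstoInDistribution_quadFormMatrix (le_max_right _ _) hy hB_meas hy_indep hBy_indep hB_symm
      h_lind hB_norm h_a₂ h_a₁⟩
  simp only [symmOfUpper_apply]
  exact iIndepFun_pi (X := fun _ x => x) fun _ => aemeasurable_id
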